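/- Let $A$ be a finite-dimensional complex Hilbert space, identified with $\mathbb{C}^n$ by an orthonormal basis $(|i\rangle)$, let $B$ be a second copy of $A$, and put $|\Phi\rangle=\sum_i|i\rangle\otimes|i\rangle\in A\otimes B$. Write $L(A)$ for the operators on $A$, and let $X\le Y$ mean that $Y-X$ is positive semidefinite. For a set $\mathcal{C}$ of positive semidefinite operators put $$\mathcal{C}^\sharp=\{X\ge 0:\operatorname{Tr}(XY)\le 1\ \text{for all } Y\in\mathcal{C}\},\qquad \operatorname{her}(\mathcal{C})=\{X\ge 0: X\le Y\ \text{for some } Y\in\mathcal{C}\}.$$ Let $S_0\subseteq L(A)$ be a unital C*-algebra (a unital $*$-subalgebra) and let $S\subseteq L(A)$ be an $S_0$-graph, i.e. a linear subspace with $S=S^\dagger$, $I\in S$, $S_0\subseteq S$ and $S_0SS_0=S$. Let $S^c=S^\perp+S_0$, where $S^\perp$ is the orthogonal complement for the inner product $\operatorname{Tr}(X^\dagger Y)$. For a non-commutative graph $S$ define: * for $W\ge 0$, $\theta(S,W)=\min\{\lambda: Y\in S\otimes L(B),\ \operatorname{Tr}_A Y\le\lambda I,\ Y\ge |r_W\rangle\langle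 r_W|\}$ with $|r_W\rangle=(\sqrt W\otimes I)|\Phi\rangle$; * $\mathrm{TH}(S)=\{X\ge0:\operatorname{Tr}(XW)\le1\text{ for all }W\ge0\text{ with }\theta(S,W)\le1\}$ and $\mathrm{TH}^\sharp(S)=(\mathrm{TH}(S))^\sharp$; * $\mathrm{FP}(S)=\operatorname{her}\big(\overline{\operatorname{conv}}\{P: P\text{ an } S\text{-full projection}\}\big)$, where an orthogonal projection $P$ is $S$-full if $P\,L(A)\,P\subseteq S$. Decompose $A=\bigoplus_{i=1}^r A_i\otimes Y_i$ with $A_i,Y_i\neq 0$ so that $S_0=\bigoplus_i L(A_i)\otimes I_{Y_i}$ (such a decomposition always exists); let $P_i$ be the projection onto $A_i\otimes Y_i$, and put $$\Psi(W)=\sum_i(\dim Y_i)^{-1}\,I_{A_i}\otimes\operatorname{Tr}_{A_i}(P_iWP_i),\qquad \mathcal{C}^{\Psi}=\{W\ge0:\Psi(W)\in\mathcal{C}\}^\sharp .$$ **Theorem.** For every $S_0$-graph $S$, and every such decomposition of $S_0$, $$\mathrm{FP}(S)\subseteq \mathrm{TH}^\sharp(S)\subseteq \mathrm{FP}(S^c)^{\Psi}.$$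 -/

import Mathlib

open Matrix
open scoped ComplexOrder

noncomputable section

namespace NCGraph

variable {n : Type*} [Fintype n] [DecidableEq n]

/-! Operators on a finite-dimensional Hilbert space `A` are written as matrices in an orthonormal
basis indexed by `n`.  The second copy `B` of the space has the same basis, and operators on
`A ⊗ B` are matrices indexed by `n × n`. -/

/-! ### Convex corners -/

/-- The hereditary closure of a set of positive semidefinite operators. -/
def her (C : Set (Matrix n n ℂ)) : Set (Matrix n n ℂ) :=
  {A | A.PosSemidef ∧ ∃ B ∈ C, (B - A).PosSemidef}

/-- The anti-blocker `C^♯`.  (The trace of a product of two positive semidefinite operators is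
real, so taking real parts loses nothing.) -/
def antiblocker (C : Set (Matrix n n ℂ)) : Set (Matrix n n ℂ) :=
  {B | B.PosSemidef ∧ ∀ A ∈ C, (A * B).trace.re ≤ 1}

/-! ### Non-commutative graphs, weighted theta and the theta body -/

/-- A non-commutative graph: an operator subspace with `S = S†` and `I ∈ S`. -/
structure IsNCGraph (S : Submodule ℂ (Matrix n n ℂ)) : Prop where
  conjTranspose_mem : ∀ X ∈ S, Xᴴ ∈ S
  one_mem : (1 : Matrix n n ℂ) ∈ S

/-- The operator space `S ⊗ L(B)`. -/
def tensorFull (S : Submodule ℂ (Matrix n n ℂ)) : Submodule ℂ (Matrix (n × n) (n × n) ℂ) :=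
  Submodule.span ℂ {Y | ∃ X ∈ S, ∃ M : Matrix n n ℂ, Y = kronecker X M}

/-- The partial trace over the first factor of a tensor product. -/
def traceA {α β : Type*} [Fintype α] (Y : Matrix (α × β) (α × β) ℂ) : Matrix β β ℂ :=
  Matrix.of fun k l => ∑ i, Y (i, k) (i, l)

/-- The maximally entangled vector `|Φ⟩ = ∑ᵢ |i⟩ ⊗ |i⟩`. -/
def maxEnt (n : Type*) [DecidableEq n] : n × n → ℂ :=
  fun p => if p.1 = p.2 then 1 else 0

open scoped MatrixOrder in
/-- The vector `|√W⟩ = (√W ⊗ I)|Φ⟩`. -/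
def sqrtVec (W : Matrix n n ℂ) : n × n → ℂ :=
  kronecker (CFC.sqrt W) (1 : Matrix n n ℂ) *ᵥ maxEnt n

/-- The operator `|v⟩⟨v|`. -/
def ketbra {m : Type*} (v : m → ℂ) : Matrix m m ℂ := vecMulVec v (star v)

/-- The weighted theta function `θ(S, W)`, the optimal value of
`min { λ : Y ∈ S ⊗ L(B), Tr_A Y ≤ λ I, Y ≥ |√W⟩⟨√W| }`. -/
def theta (S : Submodule ℂ (Matrix n n ℂ)) (W : Matrix n n ℂ) : ℝ :=
  sInf {lam : ℝ | ∃ Y ∈ tensorFull S,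
    ((lam : ℂ) • (1 : Matrix n n ℂ) - traceA Y).PosSemidef ∧
    (Y - ketbra (sqrtVec W)).PosSemidef}

/-- The theta body `TH(S)`. -/
def thetaBody (S : Submodule ℂ (Matrix n n ℂ)) : Set (Matrix n n ℂ) :=
  {X | X.PosSemidef ∧
    ∀ W : Matrix n n ℂ, W.PosSemidef → theta S W ≤ 1 → (X * W).trace.re ≤ 1}

/-! ### Full projections -/

/-- `P` is an `S`-full projection: an orthogonal projection with `P L(A) P ⊆ S`. -/
def IsFullProj (S : Submodule ℂ (Matrix n n ℂ)) (P : Matrix n n ℂ) : Prop :=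
  Pᴴ = P ∧ P * P = P ∧ ∀ X : Matrix n n ℂ, P * X * P ∈ S

/-- The convex corner `FP(S)` generated by the `S`-full projections. -/
def fp (S : Submodule ℂ (Matrix n n ℂ)) : Set (Matrix n n ℂ) :=
  her (closure (convexHull ℝ {P | IsFullProj S P}))

/-! ### `S₀`-graphs -/

/-- A non-commutative graph `S` that is a bimodule over the C*-algebra `S₀`:
`S₀ ⊆ S` and `S₀ S S₀ = S`. -/
structure IsS0Graph (S₀ : StarSubalgebra ℂ (Matrix n n ℂ)) (S : Submodule ℂ (Matrix n n ℂ)) :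
    Prop extends IsNCGraph S where
  le : ∀ X ∈ S₀, X ∈ S
  bimodule : Submodule.span ℂ {Z | ∃ K ∈ S₀, ∃ X ∈ S, ∃ L ∈ S₀, Z = K * X * L} = S

/-- The orthogonal complement of `S` for the inner product `Tr(X† Y)`. -/
def perp (S : Submodule ℂ (Matrix n n ℂ)) : Submodule ℂ (Matrix n n ℂ) where
  carrier := {Y | ∀ X ∈ S, (Xᴴ * Y).trace = 0}
  zero_mem' := by simp
  add_mem' := by
    intro a b ha hb X hX
    simp [mul_add, ha X hX, hb X hX]
  smul_mem' := by
    intro c a ha X hX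
    simp [ha X hX]

/-- The complement `S^c = S^⊥ + S₀` of an `S₀`-graph. -/
def compl (S₀ : StarSubalgebra ℂ (Matrix n n ℂ)) (S : Submodule ℂ (Matrix n n ℂ)) :
    Submodule ℂ (Matrix n n ℂ) :=
  perp S ⊔ Subalgebra.toSubmodule S₀.toSubalgebra

/-- A decomposition `A = ⨁ᵢ Aᵢ ⊗ Yᵢ` of the Hilbert space, implemented by a unitary `U`, in which
`S₀ = ⨁ᵢ L(Aᵢ) ⊗ I`. -/
structure VertexDecomposition (S₀ : StarSubalgebra ℂ (Matrix n n ℂ)) where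
  /-- the number of blocks -/
  r : ℕ
  /-- the dimensions of the spaces `Aᵢ` -/
  dA : Fin r → ℕ
  /-- the dimensions of the spaces `Yᵢ` -/
  dY : Fin r → ℕ
  dA_pos : ∀ i, 0 < dA i
  dY_pos : ∀ i, 0 < dY i
  /-- the unitary from `⨁ᵢ Aᵢ ⊗ Yᵢ` onto `A` -/
  U : Matrix n (Σ i, Fin (dA i) × Fin (dY i)) ℂ
  U_mul : U * Uᴴ = 1
  mul_U : Uᴴ * U = 1
  mem_iff : ∀ X : Matrix n n ℂ, X ∈ S₀ ↔
    ∃ M : ∀ i, Matrix (Fin (dA i)) (Fin (dA i)) ℂ,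
      X = U * blockDiagonal' (fun i => kronecker (M i) (1 : Matrix (Fin (dY i)) (Fin (dY i)) ℂ)) * Uᴴ

/-- The map `Ψ(W) = ∑ᵢ (dim Yᵢ)⁻¹ I_{Aᵢ} ⊗ Tr_{Aᵢ}(Pᵢ W Pᵢ)`, where `Pᵢ` is the projection onto
`Aᵢ ⊗ Yᵢ`. -/
def VertexDecomposition.blockscale {S₀ : StarSubalgebra ℂ (Matrix n n ℂ)}
    (𝒟 : VertexDecomposition S₀) (W : Matrix n n ℂ) : Matrix n n ℂ :=
  𝒟.U * blockDiagonal' (fun i =>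
      ((𝒟.dY i : ℂ)⁻¹) • kronecker (1 : Matrix (Fin (𝒟.dA i)) (Fin (𝒟.dA i)) ℂ)
        (traceA (blockDiag' (𝒟.Uᴴ * W * 𝒟.U) i))) * 𝒟.Uᴴ

/-- The `Ψ`-anti-blocker `C^Ψ = {W ≥ 0 : Ψ(W) ∈ C}^♯`. -/
def VertexDecomposition.psiAntiblocker {S₀ : StarSubalgebra ℂ (Matrix n n ℂ)}
    (𝒟 : VertexDecomposition S₀) (C : Set (Matrix n n ℂ)) : Set (Matrix n n ℂ) :=
  antiblocker {W | W.PosSemidef ∧ 𝒟.blockscale W ∈ C}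

/-! ### Every `S₀` has a vertex decomposition -/

section Existence

theorem sub_inner_map {E : Type*} [NormedAddCommGroup E] [InnerProductSpace ℂ E]
    {K L : Submodule ℂ E} (u : K ≃ₗᵢ[ℂ] L) (v w : K) :
    inner ℂ (u v : E) (u w : E) = inner ℂ (v : E) (w : E) := by
  rw [← Submodule.coe_inner, ← Submodule.coe_inner]
  exact LinearIsometryEquiv.inner_map_map (𝕜 := ℂ) (E := K) (E' := L) u v w

theorem sub_ext {E : Type*} [NormedAddCommGroup E] [InnerProductSpace ℂ E]
    {K : Submodule ℂ E} {v w : K}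
    (h : ∀ z : K, inner ℂ (z : E) (v : E) = inner ℂ (z : E) (w : E)) : v = w := by
  have h1 := h (v - w)
  rw [← sub_eq_zero, ← inner_sub_right, ← Submodule.coe_sub, inner_self_eq_zero] at h1
  exact sub_eq_zero.1 (Subtype.ext h1)

theorem sub_exists_adjoint {E : Type*} [NormedAddCommGroup E] [InnerProductSpace ℂ E]
    [FiniteDimensional ℂ E] {K L : Submodule ℂ E} (f : K →ₗ[ℂ] L) :
    ∃ g : L →ₗ[ℂ] K, ∀ (z : K) (v : L), inner ℂ (z : E) (g v : E) = inner ℂ (f z : E) (v : E) := by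
  refine ⟨LinearMap.adjoint (𝕜 := ℂ) (E := K) (F := L) f, fun z v => ?_⟩
  rw [← Submodule.coe_inner, ← Submodule.coe_inner]
  exact LinearMap.adjoint_inner_right (𝕜 := ℂ) (E := K) (F := L) f z v

/-- A matrix as an operator on Euclidean space. -/
abbrev op (X : Matrix n n ℂ) : EuclideanSpace ℂ n →ₗ[ℂ] EuclideanSpace ℂ n :=
  Matrix.toEuclideanLin X

theorem op_mul (X Y : Matrix n n ℂ) (v : EuclideanSpace ℂ n) : op (X * Y) v = op X (op Y v) := by
  simp [op]

theorem op_inner (X : Matrix n n ℂ) (v w : EuclideanSpace ℂ n) :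
    inner ℂ (op X v) w = inner ℂ v (op Xᴴ w) := by
  rw [show op Xᴴ = LinearMap.adjoint (op X) from
    Matrix.toEuclideanLin_conjTranspose_eq_adjoint X, LinearMap.adjoint_inner_right]

/-- A subspace invariant under `S₀`. -/
def Inv (S₀ : StarSubalgebra ℂ (Matrix n n ℂ)) (K : Submodule ℂ (EuclideanSpace ℂ n)) : Prop :=
  ∀ X ∈ S₀, ∀ v ∈ K, op X v ∈ K

/-- A minimal nonzero invariant subspace. -/
def MinInv (S₀ : StarSubalgebra ℂ (Matrix n n ℂ)) (K : Submodule ℂ (EuclideanSpace ℂ n)) : Prop :=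
  Inv S₀ K ∧ K ≠ ⊥ ∧ ∀ L, Inv S₀ L → L ≤ K → L ≠ ⊥ → L = K

/-- Intertwining linear maps between subspaces. -/
def Intw (S₀ : StarSubalgebra ℂ (Matrix n n ℂ)) {K L : Submodule ℂ (EuclideanSpace ℂ n)}
    (f : K →ₗ[ℂ] L) : Prop :=
  ∀ X ∈ S₀, ∀ v w : K, (w : EuclideanSpace ℂ n) = op X v → (f w : EuclideanSpace ℂ n) = op X (f v)

variable {S₀ : StarSubalgebra ℂ (Matrix n n ℂ)}

theorem Inv.orthogonal {K : Submodule ℂ (EuclideanSpace ℂ n)} (hK : Inv S₀ K) : Inv S₀ Kᗮ := by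
  intro X hX v hv
  rw [Submodule.mem_orthogonal] at hv ⊢
  intro u hu
  have h := hv (op Xᴴ u) (hK _ (star_mem hX) u hu)
  rwa [op_inner, conjTranspose_conjTranspose] at h

theorem exists_minInv {K : Submodule ℂ (EuclideanSpace ℂ n)} (hK : Inv S₀ K) (h0 : K ≠ ⊥) :
    ∃ L ≤ K, MinInv S₀ L := by
  obtain ⟨L, ⟨h1, h2, h3⟩, hmin⟩ := (wellFounded_lt
    (α := Submodule ℂ (EuclideanSpace ℂ n))).has_min
      {L | Inv S₀ L ∧ L ≠ ⊥ ∧ L ≤ K} ⟨K, hK, h0, le_rfl⟩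
  refine ⟨L, h3, h1, h2, fun M hM hML hM0 => ?_⟩
  by_contra hne
  exact hmin M ⟨hM, hM0, hML.trans h3⟩ (lt_of_le_of_ne hML hne)

/-- The double commutant property. -/
theorem mem_of_commutes (X : Matrix n n ℂ)
    (h : ∀ T : Matrix n n ℂ, (∀ Z ∈ S₀, T * Z = Z * T) → X * T = T * X) : X ∈ S₀ := by
  let φ : S₀ →+* Module.End ℂ (EuclideanSpace ℂ n) :=
    { toFun := fun Z => op (Z : Matrix n n ℂ)
      map_one' := by ext v; simp [op]
      map_mul' := fun a b => by ext v : 1; exact op_mul _ _ _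
      map_zero' := by simp [op]
      map_add' := fun a b => by simp [op] }
  let _ : Module S₀ (EuclideanSpace ℂ n) := Module.compHom _ φ
  have hsm : ∀ (Z : S₀) (v : EuclideanSpace ℂ n), Z • v = op (Z : Matrix n n ℂ) v := fun _ _ => rfl
  have hc : ∀ (c : ℂ) (v : EuclideanSpace ℂ n), c • v = (algebraMap ℂ S₀ c) • v := by
    intro c v
    rw [hsm]
    have : ((algebraMap ℂ S₀ c : S₀) : Matrix n n ℂ) = c • 1 := by
      rw [Algebra.algebraMap_eq_smul_one]; rfl
    rw [this]
    simp [op]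
  have : ComplementedLattice (Submodule S₀ (EuclideanSpace ℂ n)) := by
    refine ⟨fun K => ?_⟩
    let K' : Submodule ℂ (EuclideanSpace ℂ n) :=
      { carrier := K
        add_mem' := K.add_mem
        zero_mem' := K.zero_mem
        smul_mem' := fun c v hv => by rw [hc]; exact K.smul_mem _ hv }
    have hK' : Inv S₀ K' := fun Z hZ v hv => K.smul_mem ⟨Z, hZ⟩ hv
    let L : Submodule S₀ (EuclideanSpace ℂ n) :=
      { carrier := K'ᗮ
        add_mem' := K'ᗮ.add_mem
        zero_mem' := K'ᗮ.zero_mem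
        smul_mem' := fun Z v hv => hK'.orthogonal _ Z.2 v hv }
    refine ⟨L, ?_, ?_⟩
    · rw [Submodule.disjoint_def]
      intro x hx hx'
      exact Submodule.disjoint_def.1 K'.orthogonal_disjoint x hx hx'
    · rw [codisjoint_iff, eq_top_iff]
      intro x _
      obtain ⟨y, hy, z, hz, rfl⟩ := Submodule.mem_sup.1
        (show x ∈ K' ⊔ K'ᗮ by rw [Submodule.sup_orthogonal_of_hasOrthogonalProjection]; trivial)
      exact Submodule.add_mem_sup (S := K) (T := L) hy hz
  have : IsSemisimpleModule S₀ (EuclideanSpace ℂ n) := ⟨⟩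
  let f : Module.End (Module.End S₀ (EuclideanSpace ℂ n)) (EuclideanSpace ℂ n) :=
    { toFun := op X
      map_add' := map_add _
      map_smul' := by
        intro ψ v
        let T' : EuclideanSpace ℂ n →ₗ[ℂ] EuclideanSpace ℂ n :=
          { toFun := ψ
            map_add' := map_add _
            map_smul' := fun c v => by
              simp only [RingHom.id_apply]
              rw [hc, hc, map_smul] }
        obtain ⟨T, hT⟩ := Matrix.toEuclideanLin.surjective T'
        have hT' : ∀ v, op T v = ψ v := fun v => by rw [op, hT]; rfl
        have := h T (fun Z hZ => by
          apply (Matrix.toEuclideanLin (𝕜 := ℂ) (m := n) (n := n)).injective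
          ext v : 1
          have h1 := op_mul T Z v
          have h2 := op_mul Z T v
          rw [hT'] at h1 h2
          have h3 := map_smul ψ (⟨Z, hZ⟩ : S₀) v
          exact h1.trans (h3.trans h2.symm))
        simp only [RingHom.id_apply]
        change op X (ψ v) = ψ (op X v)
        rw [← hT', ← hT', ← op_mul, ← op_mul, this] }
  obtain ⟨r, hr⟩ := jacobson_density f
    (Finset.univ.image fun i => EuclideanSpace.basisFun n ℂ i)
  have : X = r := by
    apply (Matrix.toEuclideanLin (𝕜 := ℂ) (m := n) (n := n)).injective
    refine (EuclideanSpace.basisFun n ℂ).toBasis.ext fun i => ?_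
    have := hr (EuclideanSpace.basisFun n ℂ i) (by simp)
    simp only [OrthonormalBasis.coe_toBasis]
    exact this
  rw [this]
  exact r.2

/-- Schur's lemma for endomorphisms. -/
theorem Intw.scalar {K : Submodule ℂ (EuclideanSpace ℂ n)} (hK : MinInv S₀ K) {f : K →ₗ[ℂ] K}
    (hf : Intw S₀ f) : ∃ c : ℂ, ∀ v, f v = c • v := by
  have : Nontrivial K := Submodule.nontrivial_iff_ne_bot.2 hK.2.1
  obtain ⟨c, hc⟩ := Module.End.exists_eigenvalue (K := ℂ) f
  refine ⟨c, fun v => ?_⟩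
  let E := (Module.End.eigenspace f c).map K.subtype
  have hE : E = K := by
    refine hK.2.2 E ?_ (Submodule.map_subtype_le _ _) ?_
    · rintro X hX _ ⟨v, hv, rfl⟩
      have hv' : f v = c • v := Module.End.mem_eigenspace_iff.1 hv
      refine ⟨⟨op X v, hK.1 X hX v v.2⟩, ?_, rfl⟩
      refine Module.End.mem_eigenspace_iff.2 (Subtype.ext ?_)
      rw [hf X hX v ⟨op X v, hK.1 X hX v v.2⟩ rfl, hv']
      simp
    · intro h
      have := Submodule.map_injective_of_injective K.injective_subtype
        (h.trans (Submodule.map_bot _).symm)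
      exact hc this
  obtain ⟨w, hw, hwv⟩ : (v : EuclideanSpace ℂ n) ∈ E := by rw [hE]; exact v.2
  have : w = v := Subtype.ext hwv
  rw [← this]
  exact Module.End.mem_eigenspace_iff.1 hw

/-- Unitary equivalence of invariant subspaces. -/
def UEquiv (S₀ : StarSubalgebra ℂ (Matrix n n ℂ)) (K L : Submodule ℂ (EuclideanSpace ℂ n)) : Prop :=
  ∃ u : K ≃ₗᵢ[ℂ] L, Intw S₀ (u.toLinearEquiv : K →ₗ[ℂ] L)

theorem Intw.symm {K L : Submodule ℂ (EuclideanSpace ℂ n)} (hK : Inv S₀ K) {u : K ≃ₗᵢ[ℂ] L}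
    (hu : Intw S₀ (u.toLinearEquiv : K →ₗ[ℂ] L)) :
    Intw S₀ (u.symm.toLinearEquiv : L →ₗ[ℂ] K) := by
  intro X hX v w hw
  have := hu X hX (u.symm v) ⟨op X (u.symm v), hK X hX _ (u.symm v).2⟩ rfl
  have h2 : u ⟨op X (u.symm v), hK X hX _ (u.symm v).2⟩ = w := by
    apply Subtype.ext
    rw [hw]
    simpa using this
  have h3 := congrArg u.symm h2
  rw [u.symm_apply_apply] at h3
  exact (congrArg Subtype.val h3).symm

theorem Intw.comp {K L M : Submodule ℂ (EuclideanSpace ℂ n)} {f : K →ₗ[ℂ] L} {g : L →ₗ[ℂ] M}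
    (hg : Intw S₀ g) (hf : Intw S₀ f) : Intw S₀ (g ∘ₗ f) :=
  fun X hX v w hw => hg X hX (f v) (f w) (hf X hX v w hw)

theorem Intw.exists_adjoint {K L : Submodule ℂ (EuclideanSpace ℂ n)} (hK : Inv S₀ K)
    {f : K →ₗ[ℂ] L} (hf : Intw S₀ f) : ∃ g : L →ₗ[ℂ] K, Intw S₀ g ∧ ∀ (z : K) (v : L),
      inner ℂ (z : EuclideanSpace ℂ n) (g v : EuclideanSpace ℂ n) =
        inner ℂ (f z : EuclideanSpace ℂ n) (v : EuclideanSpace ℂ n) := by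
  obtain ⟨g, hg⟩ := sub_exists_adjoint f
  refine ⟨g, ?_, hg⟩
  intro X hX v w hw
  have key : g w = (⟨op X (g v), hK X hX _ (g v).2⟩ : K) := by
    apply sub_ext
    intro z
    rw [hg, hw]
    have h1 := op_inner Xᴴ (f z : EuclideanSpace ℂ n) v
    have h2 := op_inner Xᴴ (z : EuclideanSpace ℂ n) (g v)
    rw [conjTranspose_conjTranspose] at h1 h2
    rw [← h1, ← h2, ← hf Xᴴ (star_mem hX) z ⟨op Xᴴ z, hK _ (star_mem hX) z z.2⟩ rfl]
    exact (hg ⟨op Xᴴ z, hK _ (star_mem hX) z z.2⟩ v).symm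
  exact congrArg Subtype.val key

theorem UEquiv.refl (K : Submodule ℂ (EuclideanSpace ℂ n)) : UEquiv S₀ K K :=
  ⟨LinearIsometryEquiv.refl ℂ K, fun _ _ _ _ hw => hw⟩

/-- Schur's lemma: a nonzero intertwiner gives a unitary one. -/
theorem Intw.uEquiv {K L : Submodule ℂ (EuclideanSpace ℂ n)} (hK : MinInv S₀ K) (hL : MinInv S₀ L)
    {f : K →ₗ[ℂ] L} (hf : Intw S₀ f) (h0 : f ≠ 0) : UEquiv S₀ K L := by
  obtain ⟨g, hg, hgi⟩ := hf.exists_adjoint hK.1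
  obtain ⟨c, hc⟩ := (hg.comp hf).scalar hK
  have hin : ∀ v w, inner ℂ (f v : EuclideanSpace ℂ n) (f w : EuclideanSpace ℂ n) =
      c * inner ℂ (v : EuclideanSpace ℂ n) (w : EuclideanSpace ℂ n) := by
    intro v w
    have := hc w
    rw [LinearMap.comp_apply] at this
    rw [← hgi, this, Submodule.coe_smul, inner_smul_right]
  obtain ⟨v₀, hv₀⟩ : ∃ v, f v ≠ 0 := by
    by_contra h
    push Not at h
    exact h0 (LinearMap.ext h)
  have hv₀' : v₀ ≠ 0 := fun h => hv₀ (by rw [h, map_zero])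
  have hsq : ∀ v, ((‖f v‖ ^ 2 : ℝ) : ℂ) = c * ((‖v‖ ^ 2 : ℝ) : ℂ) := by
    intro v
    have := hin v v
    rw [inner_self_eq_norm_sq_to_K, inner_self_eq_norm_sq_to_K] at this
    exact_mod_cast this
  have hcv := hsq v₀
  have hp : 0 < ‖f v₀‖ / ‖v₀‖ := div_pos (norm_pos_iff.2 hv₀) (norm_pos_iff.2 hv₀')
  set s : ℝ := ‖f v₀‖ / ‖v₀‖ with hs
  have hcs : c = ((s ^ 2 : ℝ) : ℂ) := by
    have hne : ((‖v₀‖ ^ 2 : ℝ) : ℂ) ≠ 0 := by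
      norm_cast
      exact pow_ne_zero _ (norm_ne_zero_iff.2 hv₀')
    rw [eq_comm, ← mul_left_inj' hne, ← hcv, ← Complex.ofReal_mul, hs, div_pow,
      div_mul_cancel₀ _ (pow_ne_zero _ (norm_ne_zero_iff.2 hv₀'))]
  have hnorm : ∀ v, ‖f v‖ = s * ‖v‖ := by
    intro v
    have h2 : ‖f v‖ ^ 2 = (s * ‖v‖) ^ 2 := by
      rw [mul_pow]
      apply Complex.ofReal_injective
      rw [Complex.ofReal_mul, hsq, hcs]
    exact (sq_eq_sq₀ (norm_nonneg _) (by positivity)).1 h2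
  let g : K →ₗᵢ[ℂ] L :=
    { toLinearMap := ((s : ℂ)⁻¹) • f
      norm_map' := fun v => by
        rw [LinearMap.smul_apply, norm_smul, hnorm, norm_inv, Complex.norm_real,
          Real.norm_of_nonneg hp.le, inv_mul_cancel_left₀ hp.ne'] }
  have hg : Intw S₀ g.toLinearMap := by
    intro X hX v w hw
    change ((((s : ℂ)⁻¹) • f w : L) : EuclideanSpace ℂ n) = op X (((s : ℂ)⁻¹) • f v : L)
    rw [Submodule.coe_smul, Submodule.coe_smul, map_smul, hf X hX v w hw]
  have hsurj : Function.Surjective g := by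
    have hE : (LinearMap.range g.toLinearMap).map L.subtype = L := by
      refine hL.2.2 _ ?_ (Submodule.map_subtype_le _ _) ?_
      · rintro X hX _ ⟨_, ⟨v, rfl⟩, rfl⟩
        refine ⟨_, ⟨⟨op X v, hK.1 X hX v v.2⟩, rfl⟩, ?_⟩
        exact hg X hX v ⟨op X v, hK.1 X hX v v.2⟩ rfl
      · intro h
        have := Submodule.map_injective_of_injective L.injective_subtype
          (h.trans (Submodule.map_bot _).symm)
        rw [LinearMap.range_eq_bot] at this
        have h2 : g v₀ = 0 := congrArg (fun q => q v₀) this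
        exact hv₀' (norm_eq_zero.1 (by rw [← g.norm_map, h2, norm_zero]))
    intro y
    obtain ⟨w, ⟨v, hv⟩, hw⟩ : (y : EuclideanSpace ℂ n) ∈
      (LinearMap.range g.toLinearMap).map L.subtype := by rw [hE]; exact y.2
    exact ⟨v, hv.trans (Subtype.ext hw)⟩
  exact ⟨LinearIsometryEquiv.ofSurjective g hsurj, hg⟩

/-- An orthogonal decomposition into minimal invariant subspaces. -/
theorem exists_family (S₀ : StarSubalgebra ℂ (Matrix n n ℂ)) :
    ∃ F : Set (Submodule ℂ (EuclideanSpace ℂ n)), (∀ K ∈ F, MinInv S₀ K) ∧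
      F.Pairwise (fun K L => K ⟂ L) ∧ sSup F = ⊤ := by
  obtain ⟨F, hF⟩ := zorn_subset
    {F : Set (Submodule ℂ (EuclideanSpace ℂ n)) | (∀ K ∈ F, MinInv S₀ K) ∧
      F.Pairwise (fun K L => K ⟂ L)} (by
    intro c hc hchain
    refine ⟨⋃₀ c, ⟨?_, ?_⟩, fun s hs => Set.subset_sUnion_of_mem hs⟩
    · rintro K ⟨s, hs, hK⟩
      exact (hc hs).1 K hK
    · exact (Set.pairwise_sUnion hchain.directedOn).2 fun s hs => (hc hs).2)
  refine ⟨F, hF.prop.1, hF.prop.2, ?_⟩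
  by_contra hne
  have hinv : Inv S₀ (sSup F) := by
    intro X hX
    change sSup F ≤ (sSup F).comap (op X)
    refine sSup_le fun K hK v hv => ?_
    exact (le_sSup hK : K ≤ sSup F) ((hF.prop.1 K hK).1 X hX v hv)
  obtain ⟨L, hL, hLm⟩ := exists_minInv hinv.orthogonal
    (fun h => hne ((Submodule.orthogonal_eq_bot_iff).1 h))
  have hort : ∀ K ∈ F, K ⟂ L := fun K hK =>
    (Submodule.isOrtho_orthogonal_right (sSup F)).mono (le_sSup hK) hL
  have hins : insert L F ∈ {F : Set (Submodule ℂ (EuclideanSpace ℂ n)) |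
      (∀ K ∈ F, MinInv S₀ K) ∧ F.Pairwise (fun K L => K ⟂ L)} := by
    refine ⟨?_, ?_⟩
    · rintro K (rfl | hK)
      · exact hLm
      · exact hF.prop.1 K hK
    · exact hF.prop.2.insert fun K hK _ => ⟨(hort K hK).symm, hort K hK⟩
  have hLF : L ∈ F := hF.le_of_ge hins (Set.subset_insert _ _) (Set.mem_insert _ _)
  exact hLm.2.1 (Submodule.isOrtho_self.1 (hort L hLF))

/-- The compression of an operator commuting with `S₀` is an intertwiner. -/
theorem exists_compression {K L : Submodule ℂ (EuclideanSpace ℂ n)} (hL : Inv S₀ L)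
    {T : Matrix n n ℂ} (hT : ∀ Z ∈ S₀, T * Z = Z * T) :
    ∃ f : K →ₗ[ℂ] L, Intw S₀ f ∧ ∀ (z : L) (v : K),
      inner ℂ (z : EuclideanSpace ℂ n) (op T v) = inner ℂ (z : EuclideanSpace ℂ n) (f v) := by
  let f : K →ₗ[ℂ] L :=
    (LinearMap.adjoint (𝕜 := ℂ) (E := L) (F := EuclideanSpace ℂ n) L.subtype) ∘ₗ op T ∘ₗ K.subtype
  have hf : ∀ (z : L) (v : K), inner ℂ (z : EuclideanSpace ℂ n) (op T v) =
      inner ℂ (z : EuclideanSpace ℂ n) (f v) := fun z v =>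
    (LinearMap.adjoint_inner_right (𝕜 := ℂ) (E := L) (F := EuclideanSpace ℂ n)
      L.subtype z (op T v)).symm
  refine ⟨f, ?_, hf⟩
  intro X hX v w hw
  have key : f w = (⟨op X (f v), hL X hX _ (f v).2⟩ : L) := by
    apply sub_ext
    intro z
    rw [← hf, hw, ← op_mul, hT X hX, op_mul]
    have h1 := op_inner Xᴴ (z : EuclideanSpace ℂ n) (op T v)
    have h2 := op_inner Xᴴ (z : EuclideanSpace ℂ n) (f v)
    rw [conjTranspose_conjTranspose] at h1 h2
    rw [← h1, ← h2]
    exact hf ⟨op Xᴴ z, hL _ (star_mem hX) z z.2⟩ v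
  exact congrArg Subtype.val key

/-- The structure theorem: every C*-algebra `S₀ ⊆ L(A)` has a vertex decomposition. -/
theorem VertexDecomposition.nonempty (S₀ : StarSubalgebra ℂ (Matrix n n ℂ)) :
    Nonempty (VertexDecomposition S₀) := by
  classical
  obtain ⟨F, hmin, hpair, hsup⟩ := exists_family S₀
  have hV : OrthogonalFamily ℂ (fun j : F => (j.1 : Submodule ℂ (EuclideanSpace ℂ n)))
      (fun j => j.1.subtypeₗᵢ) :=
    OrthogonalFamily.of_pairwise fun j k hjk =>
      hpair j.2 k.2 fun h => hjk (Subtype.ext h)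
  have : Finite F := WellFoundedGT.finite_of_iSupIndep hV.independent fun j => (hmin _ j.2).2.1
  let st : Setoid F :=
    { r := fun j k => UEquiv S₀ j.1 k.1
      iseqv :=
        { refl := fun j => UEquiv.refl _
          symm := by
            rintro j k ⟨u, hu⟩
            exact ⟨u.symm, hu.symm (hmin _ j.2).1⟩
          trans := by
            rintro j k l ⟨u, hu⟩ ⟨w, hw⟩
            exact ⟨u.trans w, hw.comp hu⟩ } }
  let Q := Quotient st
  have : Fintype F := Fintype.ofFinite F
  let eQ : Fin (Fintype.card Q) ≃ Q := (Fintype.equivFin Q).symm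
  let kk : Fin (Fintype.card Q) → Submodule ℂ (EuclideanSpace ℂ n) := fun i => (eQ i).out.1
  have hkk : ∀ i, MinInv S₀ (kk i) := fun i => hmin _ (eQ i).out.2
  let fib : Fin (Fintype.card Q) → Type _ := fun i => {j : F // (⟦j⟧ : Q) = eQ i}
  let ey : ∀ i, Fin (Fintype.card (fib i)) ≃ fib i := fun i => (Fintype.equivFin (fib i)).symm
  have hu : ∀ i (j : fib i), UEquiv S₀ (kk i) j.1.1 := fun i j =>
    Quotient.exact ((Quotient.out_eq (eQ i)).trans j.2.symm)
  choose u hu using hu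
  let e : ∀ i, OrthonormalBasis (Fin (Module.finrank ℂ (kk i))) ℂ (kk i) := fun i =>
    stdOrthonormalBasis ℂ (kk i)
  have he : ∀ i a a', inner ℂ (e i a : EuclideanSpace ℂ n) (e i a' : EuclideanSpace ℂ n) =
      if a = a' then (1 : ℂ) else 0 := fun i =>
    orthonormal_iff_ite.1 (e i).orthonormal
  let I := Σ i : Fin (Fintype.card Q), Fin (Module.finrank ℂ (kk i)) × Fin (Fintype.card (fib i))
  let vec : I → EuclideanSpace ℂ n := fun s =>
    (u s.1 (ey s.1 s.2.2) (e s.1 s.2.1) : EuclideanSpace ℂ n)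
  -- vectors in different minimal subspaces are orthogonal
  have hoff : ∀ (j k : F), j ≠ k → ∀ v ∈ j.1, ∀ w ∈ k.1,
      inner ℂ (v : EuclideanSpace ℂ n) w = 0 := fun j k hjk v hv w hw =>
    (hpair j.2 k.2 fun h => hjk (Subtype.ext h)).inner_eq hv hw
  have hfib : ∀ i i' y y', (ey i y).1 = (ey i' y').1 → i = i' := by
    intro i i' y y' h
    apply eQ.injective
    rw [← (ey i y).2, ← (ey i' y').2, h]
  have hdist : ∀ i (y y' : Fin (Fintype.card (fib i))), y ≠ y' → (ey i y).1 ≠ (ey i y').1 :=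
    fun i y y' h h' => h ((ey i).injective (Subtype.ext h'))
  have horth : Orthonormal ℂ vec := by
    rw [orthonormal_iff_ite]
    rintro ⟨i, a, y⟩ ⟨i', a', y'⟩
    by_cases hi : i = i'
    · subst hi
      by_cases hy : y = y'
      · subst hy
        refine (sub_inner_map (u i (ey i y)) (e i a) (e i a')).trans ?_
        rw [he]
        by_cases ha : a = a'
        · subst ha
          simp
        · rw [if_neg ha, if_neg]
          intro h
          exact ha (congrArg Prod.fst (eq_of_heq (Sigma.mk.inj h).2))
      · have hne : (⟨i, a, y⟩ : I) ≠ ⟨i, a', y'⟩ := fun h =>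
          hy (congrArg Prod.snd (eq_of_heq (Sigma.mk.inj h).2))
        rw [if_neg hne]
        exact hoff _ _ (hdist i y y' hy) _ (u i (ey i y) (e i a)).2 _ (u i (ey i y') (e i a')).2
    · rw [if_neg fun h => hi (congrArg Sigma.fst h)]
      exact hoff _ _ (fun h => hi (hfib i i' y y' h)) _ (u i (ey i y) (e i a)).2 _
        (u i' (ey i' y') (e i' a')).2
  have hspan : ⊤ ≤ Submodule.span ℂ (Set.range vec) := by
    rw [← hsup]
    refine sSup_le fun K hK v hv => ?_
    let j : F := ⟨K, hK⟩
    let i := eQ.symm ⟦j⟧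
    let jj : fib i := ⟨j, (eQ.apply_symm_apply _).symm⟩
    have hex := (e i).sum_repr ((u i jj).symm ⟨v, hv⟩)
    have hex' := congrArg (fun w => ((u i jj w : K) : EuclideanSpace ℂ n)) hex
    simp only [LinearIsometryEquiv.apply_symm_apply, map_sum, map_smul] at hex'
    rw [← hex', Submodule.coe_sum]
    refine Submodule.sum_mem _ fun a _ => ?_
    rw [Submodule.coe_smul]
    refine Submodule.smul_mem _ _ (Submodule.subset_span ⟨⟨i, a, (ey i).symm jj⟩, ?_⟩)
    change (u i (ey i ((ey i).symm jj)) (e i a) : EuclideanSpace ℂ n) = _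
    have : ∀ j' : fib i, j' = jj →
        (u i j' (e i a) : EuclideanSpace ℂ n) = (u i jj (e i a) : EuclideanSpace ℂ n) := by
      rintro _ rfl; rfl
    exact this _ ((ey i).apply_symm_apply jj)
  let b : OrthonormalBasis I ℂ (EuclideanSpace ℂ n) := OrthonormalBasis.mk horth hspan
  have hcard : Fintype.card n = Fintype.card I := by
    rw [← Module.finrank_eq_card_basis b.toBasis, finrank_euclideanSpace]
  let U : Matrix n I ℂ := Matrix.of fun p s => vec s p
  have hG : ∀ (X : Matrix n n ℂ) (s t : I),
      (Uᴴ * X * U) s t = inner ℂ (vec s) (op X (vec t)) := by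
    intro X s t
    rw [EuclideanSpace.inner_eq_star_dotProduct, Matrix.mul_assoc, dotProduct_comm]
    rfl
  have hmulU : Uᴴ * U = 1 := by
    ext s t
    have := hG 1 s t
    rw [Matrix.mul_one] at this
    rw [this, show op (1 : Matrix n n ℂ) (vec t) = vec t by simp [op],
      orthonormal_iff_ite.1 horth, Matrix.one_apply]
  have hUmul : U * Uᴴ = 1 := (Matrix.mul_eq_one_comm_of_card_eq _ _ _ hcard.symm).1 hmulU
  refine ⟨⟨Fintype.card Q, fun i => Module.finrank ℂ (kk i), fun i => Fintype.card (fib i),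
    ?_, ?_, U, hUmul, hmulU, ?_⟩⟩
  · intro i
    have : Nontrivial (kk i) := Submodule.nontrivial_iff_ne_bot.2 (hkk i).2.1
    exact Module.finrank_pos
  · intro i
    exact Fintype.card_pos_iff.2 ⟨⟨(eQ i).out, Quotient.out_eq _⟩⟩
  intro X
  constructor
  · intro hX
    let M : ∀ i, Matrix (Fin (Module.finrank ℂ (kk i))) (Fin (Module.finrank ℂ (kk i))) ℂ :=
      fun i => Matrix.of fun c a =>
        inner ℂ (e i c : EuclideanSpace ℂ n) (op X (e i a))
    refine ⟨M, ?_⟩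
    have hblock : Uᴴ * X * U = blockDiagonal' (fun i => kronecker (M i)
        (1 : Matrix (Fin (Fintype.card (fib i))) (Fin (Fintype.card (fib i))) ℂ)) := by
      ext ⟨i, c, y⟩ ⟨i', a, y'⟩
      rw [hG]
      have himg := hu i' (ey i' y') X hX (e i' a)
        ⟨op X (e i' a), (hkk i').1 X hX _ (e i' a).2⟩ rfl
      change inner ℂ (u i (ey i y) (e i c) : EuclideanSpace ℂ n)
        (op X (u i' (ey i' y') (e i' a) : EuclideanSpace ℂ n)) = _
      rw [← show _ = op X (u i' (ey i' y') (e i' a) : EuclideanSpace ℂ n) from himg]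
      by_cases hi : i = i'
      · subst hi
        rw [blockDiagonal'_apply_eq]
        by_cases hy : y = y'
        · subst hy
          refine (sub_inner_map (u i (ey i y)) (e i c)
            (⟨op X (e i a), (hkk i).1 X hX _ (e i a).2⟩ : kk i)).trans ?_
          simp [M]
        · refine (hoff _ _ (hdist i y y' hy) _ (u i (ey i y) (e i c)).2 _
            (Subtype.property _)).trans ?_
          simp [hy]
      · rw [blockDiagonal'_apply_ne _ _ _ hi]
        exact hoff _ _ (fun h => hi (hfib i i' y y' h)) _ (u i (ey i y) (e i c)).2 _
          (Subtype.property _)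
    have hcalc : X = U * (Uᴴ * X * U) * Uᴴ := by
      rw [← Matrix.mul_assoc, ← Matrix.mul_assoc, hUmul, Matrix.one_mul, Matrix.mul_assoc, hUmul,
        Matrix.mul_one]
    rw [← hblock]
    exact hcalc
  · rintro ⟨M, hM⟩
    refine mem_of_commutes X fun T hT => ?_
    have hN : ∀ i (y y' : Fin (Fintype.card (fib i))), ∃ z : ℂ, ∀ c a,
        inner ℂ (vec ⟨i, c, y⟩) (op T (vec ⟨i, a, y'⟩)) = if c = a then z else 0 := by
      intro i y y'
      obtain ⟨f, hf, hfi⟩ := exists_compression (K := (ey i y').1.1) (L := (ey i y).1.1)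
        (hmin _ (ey i y).1.2).1 hT
      obtain ⟨z, hz⟩ := Intw.scalar (hkk i)
        (((hu i (ey i y)).symm (hkk i).1).comp (hf.comp (hu i (ey i y'))))
      refine ⟨z, fun c a => ?_⟩
      have h1 := hfi (u i (ey i y) (e i c)) (u i (ey i y') (e i a))
      refine h1.trans ?_
      have h2 : (u i (ey i y)).symm (f (u i (ey i y') (e i a))) = z • e i a := hz (e i a)
      have h3 : f (u i (ey i y') (e i a)) = u i (ey i y) (z • e i a) := by
        rw [← h2, LinearIsometryEquiv.apply_symm_apply]
      rw [h3, sub_inner_map, Submodule.coe_smul, inner_smul_right, he]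
      simp
    choose N hN using hN
    have hblock : Uᴴ * T * U = blockDiagonal' (fun i => kronecker
        (1 : Matrix (Fin (Module.finrank ℂ (kk i))) (Fin (Module.finrank ℂ (kk i))) ℂ)
        (Matrix.of (N i))) := by
      ext ⟨i, c, y⟩ ⟨i', a, y'⟩
      rw [hG]
      by_cases hi : i = i'
      · subst hi
        rw [blockDiagonal'_apply_eq, hN]
        simp [Matrix.one_apply]
      · rw [blockDiagonal'_apply_ne _ _ _ hi]
        obtain ⟨f, hf, hfi⟩ := exists_compression (K := (ey i' y').1.1) (L := (ey i y).1.1)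
          (hmin _ (ey i y).1.2).1 hT
        have hf0 : f = 0 := by
          by_contra hf0
          have h1 : UEquiv S₀ (ey i' y').1.1 (ey i y).1.1 :=
            hf.uEquiv (hmin _ (ey i' y').1.2) (hmin _ (ey i y).1.2) hf0
          have h2 : (⟦(ey i' y').1⟧ : Q) = ⟦(ey i y).1⟧ := Quotient.sound h1
          rw [(ey i' y').2, (ey i y).2] at h2
          exact hi (eQ.injective h2).symm
        refine (hfi (u i (ey i y) (e i c)) (u i' (ey i' y') (e i' a))).trans ?_
        rw [hf0]
        simp
    have hTc : T = U * (Uᴴ * T * U) * Uᴴ := by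
      rw [← Matrix.mul_assoc, ← Matrix.mul_assoc, hUmul, Matrix.one_mul, Matrix.mul_assoc, hUmul,
        Matrix.mul_one]
    rw [hblock] at hTc
    have hprod : ∀ P R : Matrix I I ℂ, (U * P * Uᴴ) * (U * R * Uᴴ) = U * (P * R) * Uᴴ := by
      intro P R
      calc (U * P * Uᴴ) * (U * R * Uᴴ) = U * P * (Uᴴ * U) * R * Uᴴ := by
            simp only [Matrix.mul_assoc]
        _ = U * (P * R) * Uᴴ := by rw [hmulU]; simp only [Matrix.mul_one, Matrix.mul_assoc]
    rw [hM, hTc]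
    refine (hprod _ _).trans (Eq.trans ?_ (hprod _ _).symm)
    rw [← blockDiagonal'_mul, ← blockDiagonal'_mul]
    congr 3
    funext i
    refine (Matrix.mul_kronecker_mul _ _ _ _).symm.trans
      (Eq.trans ?_ (Matrix.mul_kronecker_mul _ _ _ _))
    simp

end Existence

end NCGraph

end

/-! The first inclusion is a choice of feasible point. For an `S`-full projection `P` the operator
`|√P⟩⟨√P|` lies in `S ⊗ L(B)`, because its slices are `P |k⟩⟨l| P`, and its partial trace is `Pᵀ ≤
I`. Hence `θ(S, P) ≤ 1`, so `Tr(XP) ≤ 1` for `X ∈ TH(S)`, and this bound survives convex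
combinations, limits and passage to smaller operators.

For the second inclusion, anti-blockers reverse inclusions, so it suffices that `W ≥ 0` and `Ψ(W) ∈
FP(S^c)` imply `W ∈ TH(S)`. Let `Y`, `λ` be feasible for `θ(S, V)`, let `R = √V`, and let `E` be the
trace-preserving conditional expectation onto `S₀`, applied to the first factor.

(1) An `S^c`-full projection cannot distinguish `S` from `S₀`: `P Z P = P E(Z) P` for `Z ∈ S`
(`compress_eq`). It lies below an `S^c`-full projection `q` in the commutant of `S₀`
(`exists_fullProj_ofComm`), and for such a `q` one gets `q Z q = q E(Z)`.

(2) Testing `Y ≥ |R⟩⟨R|` at `qx` gives `|⟨qx|R⟩|² ≤ ⟨x|(q ⊗ I) E(Y)|x⟩`. The left side is convex in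
`q` and the right side is linear, so the inequality passes from projections to convex combinations
and limits. Thus `Ψ(W) ≤ q` for some `q` in the commutant satisfying it
(`exists_testSet_of_mem_fp`).

(3) Take `x` to be `q⁻¹ W R`, with a pseudo-inverse, and put `t = Tr(R† W R) = Tr(VW)`. The left
side becomes `t²`. Since `Ψ(W) ≤ q`, the right side is at most `Tr((Tr_A Y)(R† W R)ᵀ) ≤ λ t`
(`block_le`, `quad_condExp_le`). Hence `t² ≤ λ t`, and `t ≤ λ` unless `t = 0`. -/

noncomputable section

namespace NCGraph

section

/-! ### The algebra `S₀` and its commutant in a vertex decomposition -/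

/-- The partial trace over the second factor of a tensor product. -/
def traceB {α β : Type*} [Fintype β] (Y : Matrix (α × β) (α × β) ℂ) : Matrix α α ℂ :=
  Matrix.of fun a b => ∑ y, Y (a, y) (b, y)

theorem trace_one_kronecker_mul {α β : Type*} [Fintype α] [Fintype β] [DecidableEq α]
    (q : Matrix β β ℂ) (X : Matrix (α × β) (α × β) ℂ) :
    (kronecker (1 : Matrix α α ℂ) q * X).trace = (q * traceA X).trace := by
  simp only [Matrix.trace, Matrix.diag, Matrix.mul_apply, traceA, Matrix.of_apply,
    Fintype.sum_prod_type, kronecker, kroneckerMap_apply, Matrix.one_apply, Finset.mul_sum,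
    ite_mul, one_mul, zero_mul]
  rw [Finset.sum_comm]
  refine Finset.sum_congr rfl fun y _ => ?_
  rw [Finset.sum_comm]
  simp [Finset.sum_comm (s := (Finset.univ : Finset α)) (t := (Finset.univ : Finset β))]

theorem trace_kronecker_one_mul {α β : Type*} [Fintype α] [Fintype β] [DecidableEq β]
    (M : Matrix α α ℂ) (X : Matrix (α × β) (α × β) ℂ) :
    (kronecker M (1 : Matrix β β ℂ) * X).trace = (M * traceB X).trace := by
  simp only [Matrix.trace, Matrix.diag, Matrix.mul_apply, traceB, Matrix.of_apply,
    Fintype.sum_prod_type, kronecker, kroneckerMap_apply, Matrix.one_apply, Finset.mul_sum]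
  simp
  refine Finset.sum_congr rfl fun a _ => ?_
  rw [Finset.sum_comm]

theorem trace_blockDiagonal'_mul {ι : Type*} [Fintype ι] [DecidableEq ι] {m : ι → Type*}
    [∀ i, Fintype (m i)] (B : ∀ i, Matrix (m i) (m i) ℂ)
    (X : Matrix (Σ i, m i) (Σ i, m i) ℂ) :
    (blockDiagonal' B * X).trace = ∑ i, (B i * blockDiag' X i).trace := by
  simp only [Matrix.trace, Matrix.diag, Matrix.mul_apply, Fintype.sum_sigma]
  refine Finset.sum_congr rfl fun i _ => Finset.sum_congr rfl fun a _ => ?_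
  rw [Finset.sum_eq_single i]
  · simp [blockDiagonal'_apply_eq, blockDiag'_apply]
  · intro j _ hj
    simp [blockDiagonal'_apply_ne _ _ _ hj.symm]
  · simp

theorem traceA_posSemidef {α β : Type*} [Fintype α] [Fintype β]
    {X : Matrix (α × β) (α × β) ℂ} (hX : X.PosSemidef) : (traceA X).PosSemidef := by
  have : traceA X = ∑ a, X.submatrix (fun b => (a, b)) (fun b => (a, b)) := by
    ext k l
    simp [traceA, Matrix.sum_apply]
  rw [this]
  exact posSemidef_sum _ fun a _ => hX.submatrix _

namespace VertexDecomposition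

variable {n : Type*} [Fintype n] [DecidableEq n] {S₀ : StarSubalgebra ℂ (Matrix n n ℂ)}
  (𝒟 : VertexDecomposition S₀)

/-- The index set of the adapted basis. -/
abbrev Idx : Type := Σ i, Fin (𝒟.dA i) × Fin (𝒟.dY i)

theorem conj_mul_conj (X Y : Matrix 𝒟.Idx 𝒟.Idx ℂ) :
    (𝒟.U * X * 𝒟.Uᴴ) * (𝒟.U * Y * 𝒟.Uᴴ) = 𝒟.U * (X * Y) * 𝒟.Uᴴ := by
  calc (𝒟.U * X * 𝒟.Uᴴ) * (𝒟.U * Y * 𝒟.Uᴴ) = 𝒟.U * X * (𝒟.Uᴴ * 𝒟.U) * Y * 𝒟.Uᴴ := by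
        simp only [Matrix.mul_assoc]
    _ = 𝒟.U * (X * Y) * 𝒟.Uᴴ := by rw [𝒟.mul_U]; simp only [Matrix.mul_one, Matrix.mul_assoc]

theorem conj_conj (X : Matrix 𝒟.Idx 𝒟.Idx ℂ) :
    𝒟.Uᴴ * (𝒟.U * X * 𝒟.Uᴴ) * 𝒟.U = X := by
  calc 𝒟.Uᴴ * (𝒟.U * X * 𝒟.Uᴴ) * 𝒟.U = (𝒟.Uᴴ * 𝒟.U) * X * (𝒟.Uᴴ * 𝒟.U) := by
        simp only [Matrix.mul_assoc]
    _ = X := by rw [𝒟.mul_U, Matrix.one_mul, Matrix.mul_one]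

theorem trace_conj_mul (X : Matrix 𝒟.Idx 𝒟.Idx ℂ) (Y : Matrix n n ℂ) :
    (𝒟.U * X * 𝒟.Uᴴ * Y).trace = (X * (𝒟.Uᴴ * Y * 𝒟.U)).trace := by
  rw [Matrix.mul_assoc, Matrix.mul_assoc, Matrix.trace_mul_comm]
  simp only [Matrix.mul_assoc]

/-- The element `⨁ᵢ I ⊗ qᵢ` of the commutant of `S₀`. -/
def ofComm (q : ∀ i, Matrix (Fin (𝒟.dY i)) (Fin (𝒟.dY i)) ℂ) : Matrix n n ℂ :=
  𝒟.U * blockDiagonal' (fun i =>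
    kronecker (1 : Matrix (Fin (𝒟.dA i)) (Fin (𝒟.dA i)) ℂ) (q i)) * 𝒟.Uᴴ

/-- The element `⨁ᵢ Mᵢ ⊗ I` of `S₀`. -/
def ofAlg (M : ∀ i, Matrix (Fin (𝒟.dA i)) (Fin (𝒟.dA i)) ℂ) : Matrix n n ℂ :=
  𝒟.U * blockDiagonal' (fun i =>
    kronecker (M i) (1 : Matrix (Fin (𝒟.dY i)) (Fin (𝒟.dY i)) ℂ)) * 𝒟.Uᴴ

/-- The partial traces `Tr_{Aᵢ} (Pᵢ X Pᵢ)`. -/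
def tau (X : Matrix n n ℂ) (i : Fin 𝒟.r) : Matrix (Fin (𝒟.dY i)) (Fin (𝒟.dY i)) ℂ :=
  traceA (blockDiag' (𝒟.Uᴴ * X * 𝒟.U) i)

/-- The trace-preserving conditional expectation onto `S₀`. -/
def condExp (X : Matrix n n ℂ) : Matrix n n ℂ :=
  𝒟.ofAlg fun i => ((𝒟.dY i : ℂ)⁻¹) • traceB (blockDiag' (𝒟.Uᴴ * X * 𝒟.U) i)

theorem ofAlg_mem (M) : 𝒟.ofAlg M ∈ S₀ := (𝒟.mem_iff _).2 ⟨M, rfl⟩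

theorem condExp_mem (X : Matrix n n ℂ) : 𝒟.condExp X ∈ S₀ := 𝒟.ofAlg_mem _

theorem ofComm_mul (q q') : 𝒟.ofComm q * 𝒟.ofComm q' = 𝒟.ofComm fun i => q i * q' i := by
  rw [ofComm, ofComm, conj_mul_conj, ← blockDiagonal'_mul, ofComm]
  congr 3
  funext i
  exact (Matrix.mul_kronecker_mul _ _ _ _).symm.trans (by rw [Matrix.one_mul]; rfl)

theorem ofComm_mul_ofAlg (q M) : 𝒟.ofComm q * 𝒟.ofAlg M =
    𝒟.U * blockDiagonal' (fun i => kronecker (M i) (q i)) * 𝒟.Uᴴ := by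
  rw [ofComm, ofAlg, conj_mul_conj, ← blockDiagonal'_mul]
  congr 3
  funext i
  exact (Matrix.mul_kronecker_mul _ _ _ _).symm.trans (by
    rw [Matrix.one_mul, Matrix.mul_one]; rfl)

theorem ofAlg_mul_ofComm (q M) : 𝒟.ofAlg M * 𝒟.ofComm q =
    𝒟.U * blockDiagonal' (fun i => kronecker (M i) (q i)) * 𝒟.Uᴴ := by
  rw [ofComm, ofAlg, conj_mul_conj, ← blockDiagonal'_mul]
  congr 3
  funext i
  exact (Matrix.mul_kronecker_mul _ _ _ _).symm.trans (by
    rw [Matrix.one_mul, Matrix.mul_one]; rfl)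

theorem ofComm_mul_condExp (q X) :
    𝒟.ofComm q * 𝒟.condExp X = 𝒟.condExp X * 𝒟.ofComm q := by
  rw [condExp, ofComm_mul_ofAlg, ofAlg_mul_ofComm]

theorem ofComm_one : 𝒟.ofComm (fun _ => 1) = 1 := by
  have : blockDiagonal' (fun i => kronecker (1 : Matrix (Fin (𝒟.dA i)) (Fin (𝒟.dA i)) ℂ)
      (1 : Matrix (Fin (𝒟.dY i)) (Fin (𝒟.dY i)) ℂ)) = 1 := by
    rw [← blockDiagonal'_one]
    congr 1
    funext i
    exact one_kronecker_one
  rw [ofComm, this, Matrix.mul_one, 𝒟.U_mul]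

theorem ofComm_conjTranspose (q) : (𝒟.ofComm q)ᴴ = 𝒟.ofComm fun i => (q i)ᴴ := by
  rw [ofComm, conjTranspose_mul, conjTranspose_mul, conjTranspose_conjTranspose,
    blockDiagonal'_conjTranspose, ofComm, Matrix.mul_assoc]
  congr 4
  funext i
  exact (conjTranspose_kronecker _ _).trans (by rw [conjTranspose_one]; rfl)

theorem ofComm_add (q q') : 𝒟.ofComm (q + q') = 𝒟.ofComm q + 𝒟.ofComm q' := by
  rw [ofComm, ofComm, ofComm, ← Matrix.add_mul, ← Matrix.mul_add, ← blockDiagonal'_add]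
  congr 3
  funext i
  exact kronecker_add _ _ _

theorem ofComm_smul (c : ℂ) (q) : 𝒟.ofComm (c • q) = c • 𝒟.ofComm q := by
  rw [ofComm, ofComm, ← Matrix.smul_mul, ← Matrix.mul_smul, ← blockDiagonal'_smul]
  congr 3
  funext i
  exact kronecker_smul c (1 : Matrix (Fin (𝒟.dA i)) (Fin (𝒟.dA i)) ℂ) (q i)

theorem ofComm_sub (q q') : 𝒟.ofComm (q - q') = 𝒟.ofComm q - 𝒟.ofComm q' := by
  rw [sub_eq_add_neg, ofComm_add, ← neg_one_smul ℂ q', ofComm_smul, neg_one_smul, sub_eq_add_neg]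

theorem blockscale_eq (X : Matrix n n ℂ) :
    𝒟.blockscale X = 𝒟.ofComm fun i => ((𝒟.dY i : ℂ)⁻¹) • 𝒟.tau X i := by
  rw [blockscale, ofComm]
  congr 3
  funext i
  exact (kronecker_smul _ (1 : Matrix (Fin (𝒟.dA i)) (Fin (𝒟.dA i)) ℂ) (𝒟.tau X i)).symm

theorem trace_ofComm_mul (q X) :
    (𝒟.ofComm q * X).trace = ∑ i, (q i * 𝒟.tau X i).trace := by
  rw [ofComm, trace_conj_mul, trace_blockDiagonal'_mul]
  exact Finset.sum_congr rfl fun i _ => trace_one_kronecker_mul _ _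

theorem trace_ofAlg_mul (M X) :
    (𝒟.ofAlg M * X).trace = ∑ i, (M i * traceB (blockDiag' (𝒟.Uᴴ * X * 𝒟.U) i)).trace := by
  rw [ofAlg, trace_conj_mul, trace_blockDiagonal'_mul]
  exact Finset.sum_congr rfl fun i _ => trace_kronecker_one_mul _ _

theorem tau_posSemidef {X : Matrix n n ℂ} (hX : X.PosSemidef) (i) :
    (𝒟.tau X i).PosSemidef :=
  traceA_posSemidef ((hX.conjTranspose_mul_mul_same 𝒟.U).submatrix fun a => ⟨i, a⟩)

theorem tau_ofComm (q i) : 𝒟.tau (𝒟.ofComm q) i = (𝒟.dA i : ℂ) • q i := by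
  rw [tau, ofComm, conj_conj, blockDiag'_blockDiagonal']
  ext y z
  simp [traceA, kronecker]

/-- The partial traces preserve positivity and return `dim Aᵢ • q i`; the factor can be divided out
because `Aᵢ ≠ 0`. -/
theorem posSemidef_of_ofComm {q} (h : (𝒟.ofComm q).PosSemidef) (i) : (q i).PosSemidef := by
  have h1 := 𝒟.tau_posSemidef h i
  rw [tau_ofComm] at h1
  have h0 : (𝒟.dA i : ℂ) ≠ 0 := Nat.cast_ne_zero.2 (𝒟.dA_pos i).ne'
  have h2 := h1.smul (a := (𝒟.dA i : ℂ)⁻¹) (by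
    rw [inv_nonneg]
    exact Nat.cast_nonneg _)
  rwa [smul_smul, inv_mul_cancel₀ h0, one_smul] at h2

/-- Pairing with `Mᵢ ⊗ I` sees only the partial trace over `Yᵢ`, and the normalisation `(dim Yᵢ)⁻¹`
makes `condExp` preserve it. So `X - condExp X` is trace-orthogonal to `S₀`. -/
theorem trace_mul_condExp {K : Matrix n n ℂ} (hK : K ∈ S₀) (X : Matrix n n ℂ) :
    (K * 𝒟.condExp X).trace = (K * X).trace := by
  obtain ⟨M, hM⟩ := (𝒟.mem_iff K).1 hK
  have hM' : K = 𝒟.ofAlg M := hM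
  rw [hM', trace_ofAlg_mul, trace_ofAlg_mul]
  refine Finset.sum_congr rfl fun i _ => ?_
  rw [condExp, ofAlg, conj_conj, blockDiag'_blockDiagonal']
  congr 2
  have h0 : (𝒟.dY i : ℂ) ≠ 0 := Nat.cast_ne_zero.2 (𝒟.dY_pos i).ne'
  ext a b
  simp [traceB, kronecker, mul_inv_cancel_left₀ h0]

end VertexDecomposition

end

section

/-! ### Positive semidefinite matrices -/

section PosSemidef

variable {m k : Type*} [Fintype m] [DecidableEq m] [Fintype k]

open scoped MatrixOrder in
theorem exists_sqrt {A : Matrix m m ℂ} (hA : A.PosSemidef) :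
    ∃ B : Matrix m m ℂ, B.PosSemidef ∧ B * B = A :=
  ⟨CFC.sqrt A, nonneg_iff_posSemidef.1 (CFC.sqrt_nonneg A),
    CFC.sqrt_mul_sqrt_self A hA.nonneg⟩

theorem trace_mul_nonneg {A B : Matrix m m ℂ} (hA : A.PosSemidef)
    (hB : B.PosSemidef) : 0 ≤ (A * B).trace := by
  obtain ⟨C, hC, rfl⟩ := exists_sqrt hA
  rw [Matrix.mul_assoc, Matrix.trace_mul_comm]
  have := (hB.conjTranspose_mul_mul_same C).trace_nonneg
  rwa [hC.1] at this

/-- With `A = C²`, the trace is the squared Hilbert–Schmidt norm of `C σ`. -/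
theorem mul_eq_zero_of_trace {A : Matrix m m ℂ} (hA : A.PosSemidef)
    {σ : Matrix m k ℂ} (h : (σᴴ * A * σ).trace = 0) : A * σ = 0 := by
  obtain ⟨C, hC, rfl⟩ := exists_sqrt hA
  have h1 : ((C * σ)ᴴ * (C * σ)).trace = 0 := by
    rw [← h, conjTranspose_mul, hC.1]
    simp only [Matrix.mul_assoc]
  rw [Matrix.mul_assoc, trace_conjTranspose_mul_self_eq_zero_iff.1 h1, Matrix.mul_zero]

/-- A Hermitian matrix fixing a positive semidefinite `q` fixes everything below `q`. -/
theorem mul_eq_self_of_le {A q p : Matrix m m ℂ} (hA : A.PosSemidef)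
    (hle : (q - A).PosSemidef) (hp : pᴴ = p) (hpq : p * q = q) : p * A = A := by
  have hσ : (1 - p)ᴴ = 1 - p := by rw [conjTranspose_sub, conjTranspose_one, hp]
  have hqσ : (1 - p) * q = 0 := by rw [Matrix.sub_mul, Matrix.one_mul, hpq, sub_self]
  -- Compressing `q - A` by `1 - p` kills `q`, so the compression of `A` has trace both `≤ 0` and `≥
  -- 0`.
  have h1 := (hle.conjTranspose_mul_mul_same (1 - p)).trace_nonneg
  have h2 := (hA.conjTranspose_mul_mul_same (1 - p)).trace_nonneg
  rw [hσ, Matrix.mul_sub (1 - p) q A, hqσ, zero_sub, Matrix.neg_mul, Matrix.trace_neg, neg_nonneg] at h1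
  rw [hσ] at h2
  have h3 := mul_eq_zero_of_trace hA (σ := 1 - p) (by rw [hσ]; exact le_antisymm h1 h2)
  have h4 := congrArg conjTranspose h3
  rw [conjTranspose_mul, hA.1, hσ, conjTranspose_zero, Matrix.sub_mul, Matrix.one_mul] at h4
  exact (sub_eq_zero.1 h4).symm

/-- The square root of the pseudo-inverse of a positive semidefinite matrix. -/
theorem exists_pinv_sqrt {q : Matrix m m ℂ} (hq : q.PosSemidef) :
    ∃ C : Matrix m m ℂ, Cᴴ = C ∧ C * q = q * C ∧ q * C * C * q = q := by
  have hs := hq.1.spectral_theorem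
  set V : Matrix m m ℂ := (hq.1.eigenvectorUnitary : Matrix m m ℂ) with hV
  set ev := hq.1.eigenvalues
  have hVV : Vᴴ * V = 1 := Unitary.coe_star_mul_self hq.1.eigenvectorUnitary
  have hs' : q = V * diagonal (fun i => (ev i : ℂ)) * Vᴴ := hs
  have hprod : ∀ a b : m → ℂ, (V * diagonal a * Vᴴ) * (V * diagonal b * Vᴴ) =
      V * diagonal (fun i => a i * b i) * Vᴴ := by
    intro a b
    calc (V * diagonal a * Vᴴ) * (V * diagonal b * Vᴴ)
        = V * diagonal a * (Vᴴ * V) * diagonal b * Vᴴ := by simp only [Matrix.mul_assoc]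
      _ = V * (diagonal a * diagonal b) * Vᴴ := by
        rw [hVV]; simp only [Matrix.mul_one, Matrix.mul_assoc]
      _ = _ := by rw [diagonal_mul_diagonal]
  -- The convention `0⁻¹ = 0` makes this matrix vanish on the kernel of `q`, as a pseudo-inverse
  -- must.
  refine ⟨V * diagonal (fun i => (((Real.sqrt (ev i))⁻¹ : ℝ) : ℂ)) * Vᴴ, ?_, ?_, ?_⟩
  · rw [conjTranspose_mul, conjTranspose_mul, conjTranspose_conjTranspose,
      diagonal_conjTranspose, Matrix.mul_assoc]
    congr 3
    funext i
    simp
  · rw [hs', hprod, hprod]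
    simp only [mul_comm]
  · rw [hs', hprod, hprod, hprod]
    congr 3
    funext i
    rw [← Complex.ofReal_mul, ← Complex.ofReal_mul, ← Complex.ofReal_mul]
    congr 1
    have h0 : 0 ≤ ev i := hq.eigenvalues_nonneg i
    rcases h0.eq_or_lt with h | h
    · simp [← h]
    · have h1 := Real.mul_self_sqrt h0
      have h2 : Real.sqrt (ev i) ≠ 0 := (Real.sqrt_pos.2 h).ne'
      calc ev i * (√(ev i))⁻¹ * (√(ev i))⁻¹ * ev i
          = ev i * ((√(ev i) * √(ev i))⁻¹ * ev i) := by rw [mul_inv]; ring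
        _ = ev i := by rw [h1, inv_mul_cancel₀ h.ne', mul_one]

theorem posSemidef_of_proj {m : Type*} [Fintype m] {p : Matrix m m ℂ} (hp : pᴴ = p) (hpp : p * p = p) :
    p.PosSemidef := by
  have := posSemidef_conjTranspose_mul_self p
  rwa [hp, hpp] at this

theorem posSemidef_one_sub_of_proj {p : Matrix m m ℂ} (hp : pᴴ = p) (hpp : p * p = p) :
    (1 - p).PosSemidef := by
  apply posSemidef_of_proj
  · rw [conjTranspose_sub, conjTranspose_one, hp]
  · rw [Matrix.sub_mul 1 p, Matrix.mul_sub p, hpp, Matrix.mul_one, sub_self, sub_zero,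
      Matrix.one_mul]

/-- A row contraction is a contraction. -/
theorem posSemidef_sub_conjTranspose_mul [DecidableEq k] {T : Matrix m k ℂ} {d : ℂ} (hd : 0 < d)
    (h : (d • (1 : Matrix m m ℂ) - T * Tᴴ).PosSemidef) :
    (d • (1 : Matrix k k ℂ) - Tᴴ * T).PosSemidef := by
  have hdd : star d = d :=
     Complex.conj_eq_iff_im.2 (Complex.pos_iff.1 hd).2.symm
  have h1 : (d • (1 : Matrix k k ℂ) - Tᴴ * T)ᴴ = d • (1 : Matrix k k ℂ) - Tᴴ * T := by
    simp [conjTranspose_sub, hdd]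
  have h2 := posSemidef_conjTranspose_mul_self (d • (1 : Matrix k k ℂ) - Tᴴ * T)
  have h3 := h2.add (h.conjTranspose_mul_mul_same T)
  -- With `X = d - T†T`, the identity `X² + T†(d - TT†)T = dX` writes `dX` as a sum of two positive
  -- terms.
  have h4 : (d • (1 : Matrix k k ℂ) - Tᴴ * T)ᴴ * (d • (1 : Matrix k k ℂ) - Tᴴ * T) +
      Tᴴ * (d • (1 : Matrix m m ℂ) - T * Tᴴ) * T = d • (d • (1 : Matrix k k ℂ) - Tᴴ * T) := by
    rw [h1]
    simp only [Matrix.sub_mul, Matrix.mul_sub, smul_mul, Matrix.mul_smul, Matrix.one_mul,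
      Matrix.mul_one, smul_sub, Matrix.mul_assoc]
    abel
  rw [h4] at h3
  have h5 := h3.smul (a := d⁻¹) (inv_nonneg.2 hd.le)
  rwa [smul_smul, inv_mul_cancel₀ hd.ne', one_smul] at h5

end PosSemidef

/-! ### The complement of an `S₀`-graph -/

variable {n : Type*} [Fintype n] [DecidableEq n] {S₀ : StarSubalgebra ℂ (Matrix n n ℂ)}
  {S : Submodule ℂ (Matrix n n ℂ)}

theorem IsS0Graph.mul_mem (hS : IsS0Graph S₀ S) {K X L : Matrix n n ℂ} (hK : K ∈ S₀)
    (hX : X ∈ S) (hL : L ∈ S₀) : K * X * L ∈ S := by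
  rw [← hS.bimodule]
  exact Submodule.subset_span ⟨K, hK, X, hX, L, hL, rfl⟩

/-- By cyclicity of the trace, factors from `S₀` move as adjoints onto the element of `S`, so `S^⊥`
inherits the bimodule property. -/
theorem mul_mem_compl (hS : IsS0Graph S₀ S) {K X L : Matrix n n ℂ} (hK : K ∈ S₀)
    (hX : X ∈ compl S₀ S) (hL : L ∈ S₀) : K * X * L ∈ compl S₀ S := by
  obtain ⟨z, hz, s, hs, rfl⟩ := Submodule.mem_sup.1 hX
  rw [Matrix.mul_add, Matrix.add_mul]
  refine Submodule.add_mem_sup ?_ ?_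
  · intro Z hZ
    have h := hz (Kᴴ * Z * Lᴴ) (hS.mul_mem (star_mem hK) hZ (star_mem hL))
    rw [conjTranspose_mul, conjTranspose_mul, conjTranspose_conjTranspose,
      conjTranspose_conjTranspose, Matrix.mul_assoc, Matrix.trace_mul_comm] at h
    rw [← h]
    simp only [Matrix.mul_assoc]
  · exact S₀.mul_mem (S₀.mul_mem hK hs) hL

namespace VertexDecomposition

variable (𝒟 : VertexDecomposition S₀)

/-- Compression by a full projection of the complement maps `S` into `S₀`. -/
theorem compress_eq (hS : IsS0Graph S₀ S) {P : Matrix n n ℂ}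
    (hP : IsFullProj (compl S₀ S) P) {Y : Matrix n n ℂ} (hY : Y ∈ S) :
    P * Y * P = P * 𝒟.condExp Y * P := by
  have hD : Y - 𝒟.condExp Y ∈ S := S.sub_mem hY (hS.le _ (𝒟.condExp_mem Y))
  -- Fullness splits `P X P` as `z + s` with `z ∈ S^⊥`, `s ∈ S₀`. Since `Y - E(Y)` lies in `S`, it
  -- pairs to zero with `z`; by the trace property of `E` it pairs to zero with `s`.
  have key : ∀ X, (X * (P * (Y - 𝒟.condExp Y) * P)).trace = 0 := by
    intro X
    obtain ⟨z, hz, s, hs, h⟩ := Submodule.mem_sup.1 (hP.2.2 X)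
    have h1 : (X * (P * (Y - 𝒟.condExp Y) * P)).trace =
        (P * X * P * (Y - 𝒟.condExp Y)).trace := by
      rw [← Matrix.mul_assoc, Matrix.trace_mul_comm]
      simp only [Matrix.mul_assoc]
    have h2 := hz _ (hS.conjTranspose_mem _ hD)
    rw [conjTranspose_conjTranspose, Matrix.trace_mul_comm] at h2
    rw [h1, ← h, Matrix.add_mul, Matrix.trace_add, h2, zero_add, Matrix.mul_sub,
      Matrix.trace_sub, 𝒟.trace_mul_condExp hs, sub_self]
  have h0 := trace_conjTranspose_mul_self_eq_zero_iff.1 (key (P * (Y - 𝒟.condExp Y) * P)ᴴ)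
  rwa [Matrix.mul_sub, Matrix.sub_mul, sub_eq_zero] at h0

/-! ### Matrix units of `S₀` and full projections in the commutant. -/

/-- The isometry `y ↦ U (a ⊗ y)` from `Yᵢ`, for a basis vector `a` of `Aᵢ`. -/
def inj (i : Fin 𝒟.r) (a : Fin (𝒟.dA i)) : Matrix n (Fin (𝒟.dY i)) ℂ :=
  Matrix.of fun p y => 𝒟.U p ⟨i, a, y⟩

theorem conj_blockDiagonal'_kronecker (M : ∀ i, Matrix (Fin (𝒟.dA i)) (Fin (𝒟.dA i)) ℂ)
    (q : ∀ i, Matrix (Fin (𝒟.dY i)) (Fin (𝒟.dY i)) ℂ) :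
    𝒟.U * blockDiagonal' (fun i => kronecker (M i) (q i)) * 𝒟.Uᴴ =
      ∑ i, ∑ a, ∑ b, M i a b • (𝒟.inj i a * q i * (𝒟.inj i b)ᴴ) := by
  ext p p'
  simp only [Matrix.mul_apply, Matrix.sum_apply, Fintype.sum_sigma, conjTranspose_apply,
    Matrix.smul_apply, inj, Matrix.of_apply, smul_eq_mul]
  refine Finset.sum_congr rfl fun j _ => ?_
  have h : ∀ t : Fin (𝒟.dA j) × Fin (𝒟.dY j), ∑ i, ∑ s : Fin (𝒟.dA i) × Fin (𝒟.dY i),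
      𝒟.U p ⟨i, s⟩ * blockDiagonal' (fun i => kronecker (M i) (q i)) ⟨i, s⟩ ⟨j, t⟩ =
      ∑ a, ∑ y, 𝒟.U p ⟨j, a, y⟩ * (M j a t.1 * q j y t.2) := by
    intro t
    rw [Finset.sum_eq_single j, Fintype.sum_prod_type]
    · simp only [blockDiagonal'_apply_eq, kronecker, kroneckerMap_apply]
    · intro i _ hi
      refine Finset.sum_eq_zero fun s _ => ?_
      rw [blockDiagonal'_apply_ne _ _ _ hi, mul_zero]
    · simp
  simp only [h]
  simp only [Fintype.sum_prod_type, Finset.mul_sum, Finset.sum_mul]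
  conv_rhs => rw [Finset.sum_comm]
  refine Finset.sum_congr rfl fun b _ => ?_
  rw [Finset.sum_comm]
  refine Finset.sum_congr rfl fun a _ => Finset.sum_congr rfl fun z _ =>
    Finset.sum_congr rfl fun y _ => ?_
  ring

theorem ofComm_eq_sum (q) : 𝒟.ofComm q = ∑ i, ∑ a, 𝒟.inj i a * q i * (𝒟.inj i a)ᴴ := by
  rw [ofComm, conj_blockDiagonal'_kronecker]
  refine Finset.sum_congr rfl fun i _ => Finset.sum_congr rfl fun a _ => ?_
  simp [Matrix.one_apply]

theorem ofAlg_eq_sum (M) :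
    𝒟.ofAlg M = ∑ i, ∑ a, ∑ b, M i a b • (𝒟.inj i a * (𝒟.inj i b)ᴴ) := by
  rw [ofAlg, conj_blockDiagonal'_kronecker]
  simp

theorem inj_mul_inj_mem (i a b) : 𝒟.inj i a * (𝒟.inj i b)ᴴ ∈ S₀ := by
  have : 𝒟.inj i a * (𝒟.inj i b)ᴴ = 𝒟.ofAlg (Pi.single i (Matrix.single a b 1)) := by
    rw [ofAlg_eq_sum, Finset.sum_eq_single i, Finset.sum_eq_single a, Finset.sum_eq_single b]
    · simp
    · intro b' _ hb
      simp [hb.symm]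
    · simp
    · intro a' _ ha
      simp [ha.symm]
    · simp
    · intro j _ hj
      simp [Pi.single_eq_of_ne hj]
    · simp
  rw [this]
  exact 𝒟.ofAlg_mem _

theorem tau_eq_sum (X : Matrix n n ℂ) (i) :
    𝒟.tau X i = ∑ a, (𝒟.inj i a)ᴴ * X * 𝒟.inj i a := by
  ext y z
  simp only [tau, traceA, Matrix.of_apply, Matrix.sum_apply, blockDiag'_apply]
  rfl

/-- Averaging over the matrix units of `S₀` lands in the commutant. The form `∑ K X K†` with `K ∈
S₀` lets membership in an `S₀`-bimodule pass from `X`-sandwiches to the average. -/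
theorem ofComm_tau (X : Matrix n n ℂ) :
    𝒟.ofComm (𝒟.tau X) = ∑ i, ∑ a, ∑ b,
      (𝒟.inj i a * (𝒟.inj i b)ᴴ) * X * (𝒟.inj i b * (𝒟.inj i a)ᴴ) := by
  rw [ofComm_eq_sum]
  refine Finset.sum_congr rfl fun i _ => Finset.sum_congr rfl fun a _ => ?_
  rw [tau_eq_sum, Matrix.mul_sum, Matrix.sum_mul]
  refine Finset.sum_congr rfl fun b _ => ?_
  simp only [Matrix.mul_assoc]

/-- An element of the commutant fixing all `Tr_{Aᵢ} (Pᵢ W Pᵢ)` fixes `W`. -/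
theorem ofComm_mul_eq_self {W : Matrix n n ℂ} (hW : W.PosSemidef)
    {p : ∀ i, Matrix (Fin (𝒟.dY i)) (Fin (𝒟.dY i)) ℂ} (hp : ∀ i, (p i)ᴴ = p i)
    (h : ∀ i, p i * 𝒟.tau W i = 𝒟.tau W i) : 𝒟.ofComm p * W = W := by
  have hσ : 1 - 𝒟.ofComm p = 𝒟.ofComm fun i => 1 - p i := by
    rw [← ofComm_one, ← ofComm_sub]
    rfl
  have hσ' : (1 - 𝒟.ofComm p)ᴴ = 1 - 𝒟.ofComm p := by
    rw [conjTranspose_sub, conjTranspose_one, ofComm_conjTranspose]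
    simp only [hp]
  have hτ : ∀ i, (1 - p i) * 𝒟.tau W i = 0 := fun i => by
    rw [Matrix.sub_mul, Matrix.one_mul, h, sub_self]
  have h3 := mul_eq_zero_of_trace hW (σ := 1 - 𝒟.ofComm p) (by
    -- A trace against the commutant depends on `W` only through its partial traces, which `1 - p`
    -- annihilates.
    rw [hσ', Matrix.trace_mul_comm, ← Matrix.mul_assoc, hσ, ofComm_mul, trace_ofComm_mul]
    refine Finset.sum_eq_zero fun i _ => ?_
    rw [Matrix.mul_assoc, hτ, Matrix.mul_zero, Matrix.trace_zero])
  have h4 := congrArg conjTranspose h3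
  rw [conjTranspose_mul, hW.1, hσ', conjTranspose_zero, Matrix.sub_mul, Matrix.one_mul] at h4
  exact (sub_eq_zero.1 h4).symm

/-- Every full projection of the complement lies below one in the commutant of `S₀`. -/
theorem exists_fullProj_ofComm (hS : IsS0Graph S₀ S) {P : Matrix n n ℂ}
    (hP : IsFullProj (compl S₀ S) P) :
    ∃ q : ∀ i, Matrix (Fin (𝒟.dY i)) (Fin (𝒟.dY i)) ℂ,
      (∀ i, (q i)ᴴ = q i) ∧ (∀ i, q i * q i = q i) ∧
      IsFullProj (compl S₀ S) (𝒟.ofComm q) ∧ (𝒟.ofComm q - P).PosSemidef := by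
  have hPP := posSemidef_of_proj hP.1 hP.2.1
  choose C hC1 hC2 hC3 using fun i => exists_pinv_sqrt (𝒟.tau_posSemidef hPP i)
  let N := 𝒟.tau P
  -- As `C²` is the pseudo-inverse of `N`, this is the support projection of `N`.
  let q := fun i => N i * (C i * C i)
  have hq' : ∀ i, q i = (C i * C i) * N i := fun i => by
    simp only [q, N]
    rw [← Matrix.mul_assoc, ← hC2, Matrix.mul_assoc, ← hC2, Matrix.mul_assoc]
  have hqN : ∀ i, q i * N i = N i := fun i => by
    simp only [q, N]
    rw [← Matrix.mul_assoc, hC3]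
  have hqh : ∀ i, (q i)ᴴ = q i := fun i => by
    conv_rhs => rw [hq']
    simp only [q]
    rw [conjTranspose_mul, conjTranspose_mul, hC1, (𝒟.tau_posSemidef hPP i).1]
  have hqq : ∀ i, q i * q i = q i := fun i => by
    conv_lhs => enter [2]; simp only [q]
    rw [← Matrix.mul_assoc, hqN]
  have hh : (𝒟.ofComm q)ᴴ = 𝒟.ofComm q := by
    rw [ofComm_conjTranspose]
    simp only [hqh]
  have hi : 𝒟.ofComm q * 𝒟.ofComm q = 𝒟.ofComm q := by
    rw [ofComm_mul]
    simp only [hqq]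
  have hqP : 𝒟.ofComm q * P = P := 𝒟.ofComm_mul_eq_self hPP hqh hqN
  have hPq : P * 𝒟.ofComm q = P := by
    have := congrArg conjTranspose hqP
    rwa [conjTranspose_mul, hP.1, hh] at this
  refine ⟨q, hqh, hqq, ⟨hh, hi, fun X => ?_⟩, ?_⟩
  -- Write `q X q = N (C² X C²) N`. Expanding both `N` in matrix units gives a sum of terms `K P (⋯)
  -- P L` with `K, L ∈ S₀`, whose inner part is in `S^c` by fullness of `P`.
  · have h1 : 𝒟.ofComm q = 𝒟.ofComm N * 𝒟.ofComm fun i => C i * C i := by rw [ofComm_mul]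
    have h2 : 𝒟.ofComm q = (𝒟.ofComm fun i => C i * C i) * 𝒟.ofComm N := by
      rw [ofComm_mul]
      exact congrArg _ (funext hq')
    have h3 : 𝒟.ofComm q * X * 𝒟.ofComm q = 𝒟.ofComm N *
        ((𝒟.ofComm fun i => C i * C i) * X * 𝒟.ofComm fun i => C i * C i) * 𝒟.ofComm N := by
      conv_lhs => rw [h1]
      conv_lhs => enter [2]; rw [← h1, h2]
      simp only [Matrix.mul_assoc]
    rw [h3, show N = 𝒟.tau P from rfl, ofComm_tau]
    simp only [Matrix.sum_mul, Matrix.mul_sum]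
    refine Submodule.sum_mem _ fun i _ => Submodule.sum_mem _ fun a _ =>
      Submodule.sum_mem _ fun b _ => Submodule.sum_mem _ fun i' _ =>
      Submodule.sum_mem _ fun a' _ => Submodule.sum_mem _ fun b' _ => ?_
    have := mul_mem_compl hS (𝒟.inj_mul_inj_mem i' a' b') (hP.2.2
      ((𝒟.inj i' b' * (𝒟.inj i' a')ᴴ) * ((𝒟.ofComm fun i => C i * C i) * X *
        𝒟.ofComm fun i => C i * C i) * (𝒟.inj i a * (𝒟.inj i b)ᴴ))) (𝒟.inj_mul_inj_mem i b a)
    simpa only [Matrix.mul_assoc] using this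
  · apply posSemidef_of_proj
    · rw [conjTranspose_sub, hh, hP.1]
    · rw [Matrix.sub_mul, Matrix.mul_sub, Matrix.mul_sub, hi, hqP, hPq, hP.2.1]
      abel

end VertexDecomposition

end

section

/-! ### Operators on the tensor product as matrices of operators -/

section Slices

variable {n m : Type*}

/-- The operator `(I ⊗ ⟨k|) Y (I ⊗ |l⟩)`. -/
def slice (Y : Matrix (n × m) (n × m) ℂ) (k l : m) : Matrix n n ℂ :=
  Matrix.of fun i j => Y (i, k) (j, l)

/-- The value `⟨x|F|x⟩` of an operator given by its slices at the vector with matrix `X`. -/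
def quad [Fintype n] [Fintype m] (F : m → m → Matrix n n ℂ) (X : Matrix n m ℂ) : ℂ :=
  ∑ k, ∑ l, (Xᴴ * F k l * X) k l

theorem slice_mem [DecidableEq n] [Fintype n] {S : Submodule ℂ (Matrix n n ℂ)} {Y : Matrix (n × n) (n × n) ℂ}
    (hY : Y ∈ tensorFull S) (k l : n) : slice Y k l ∈ S := by
  induction hY using Submodule.span_induction with
  | mem Y h =>
    obtain ⟨X, hX, M, rfl⟩ := h
    have : slice (kronecker X M) k l = M k l • X := by
      ext i j
      simp [slice, kronecker, mul_comm]
    rw [this]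
    exact S.smul_mem _ hX
  | zero => exact S.zero_mem
  | add Y Z _ _ hY hZ => exact S.add_mem hY hZ
  | smul c Y _ hY => exact S.smul_mem c hY

/-- Together with `slice_mem`, this reduces membership in `S ⊗ L(B)` to membership of every slice in
`S`. -/
theorem mem_tensorFull [DecidableEq n] [Fintype n] {S : Submodule ℂ (Matrix n n ℂ)} {Y : Matrix (n × n) (n × n) ℂ}
    (h : ∀ k l, slice Y k l ∈ S) : Y ∈ tensorFull S := by
  have : Y = ∑ k, ∑ l, kronecker (slice Y k l) (Matrix.single k l (1 : ℂ)) := by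
    ext ⟨i, k⟩ ⟨j, l⟩
    simp only [Matrix.sum_apply, kronecker, kroneckerMap_apply, Matrix.single_apply, slice,
      Matrix.of_apply]
    rw [Finset.sum_eq_single k, Finset.sum_eq_single l]
    · simp
    · intro l' _ h'
      simp [h']
    · simp
    · intro k' _ h'
      simp [h']
    · simp
  rw [this]
  exact Submodule.sum_mem _ fun k _ => Submodule.sum_mem _ fun l _ =>
    Submodule.subset_span ⟨_, h k l, _, rfl⟩

theorem quad_slice [Fintype n] [Fintype m] (Y : Matrix (n × m) (n × m) ℂ) (X : Matrix n m ℂ) :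
    quad (slice Y) X = star (fun p : n × m => X p.1 p.2) ⬝ᵥ (Y *ᵥ fun p : n × m => X p.1 p.2) := by
  simp only [quad, slice, Matrix.mul_apply, dotProduct, mulVec, Fintype.sum_prod_type,
    conjTranspose_apply, Matrix.of_apply, Pi.star_apply, Finset.mul_sum, Finset.sum_mul]
  rw [Finset.sum_comm (s := (Finset.univ : Finset n))]
  refine Finset.sum_congr rfl fun k _ => ?_
  rw [Finset.sum_comm]
  conv_lhs => enter [2, j]; rw [Finset.sum_comm]
  rw [Finset.sum_comm]
  refine Finset.sum_congr rfl fun i _ => Finset.sum_congr rfl fun j _ =>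
    Finset.sum_congr rfl fun l _ => ?_
  rw [mul_assoc]

theorem star_dotProduct_ketbra {ι : Type*} [Fintype ι] (v x : ι → ℂ) :
    star x ⬝ᵥ (ketbra v *ᵥ x) = ((Complex.normSq (star x ⬝ᵥ v) : ℝ) : ℂ) := by
  have h : star v ⬝ᵥ x = star (star x ⬝ᵥ v) := star_dotProduct v x
  rw [ketbra, vecMulVec_mulVec, Complex.normSq_eq_conj_mul_self, h]
  simp

/-- Vectors of the tensor product are treated as matrices: `⟨x|r⟩` becomes `Tr(X†R)`, and the
hypothesis is evaluated at `x`. -/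
theorem normSq_trace_le_quad [Fintype n] [Fintype m] {Y : Matrix (n × m) (n × m) ℂ} {R : Matrix n m ℂ}
    (h : (Y - ketbra fun p : n × m => R p.1 p.2).PosSemidef) (X : Matrix n m ℂ) :
    ((Complex.normSq (Xᴴ * R).trace : ℝ) : ℂ) ≤ quad (slice Y) X := by
  have h1 := h.dotProduct_mulVec_nonneg fun p : n × m => X p.1 p.2
  rw [Matrix.sub_mulVec, dotProduct_sub, sub_nonneg, star_dotProduct_ketbra, ← quad_slice] at h1
  convert h1 using 4
  simp only [Matrix.trace, Matrix.diag, Matrix.mul_apply, dotProduct, Fintype.sum_prod_type,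
    conjTranspose_apply, Pi.star_apply]
  rw [Finset.sum_comm]

end Slices

variable {n : Type*} [Fintype n] [DecidableEq n] {S₀ : StarSubalgebra ℂ (Matrix n n ℂ)}

namespace VertexDecomposition

variable (𝒟 : VertexDecomposition S₀)

/-! ### Bounding the quadratic form of the conditional expectation by `Tr_A Y`. -/

theorem ofComm_mul_condExp_eq_sum (D) (Y : Matrix n n ℂ) :
    𝒟.ofComm D * 𝒟.condExp Y = ∑ i, ∑ a, ∑ b,
      ((𝒟.dY i : ℂ)⁻¹ * ((𝒟.inj i a)ᴴ * Y * 𝒟.inj i b).trace) •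
      (𝒟.inj i a * D i * (𝒟.inj i b)ᴴ) := by
  rw [condExp, ofComm_mul_ofAlg, conj_blockDiagonal'_kronecker]
  rfl

theorem sum_trace_inj (Y : Matrix n n ℂ) :
    ∑ i, ∑ a, ((𝒟.inj i a)ᴴ * Y * 𝒟.inj i a).trace = Y.trace := by
  have h1 : ∑ i, ∑ a, 𝒟.inj i a * (𝒟.inj i a)ᴴ = 1 := by
    rw [← 𝒟.ofComm_one, ofComm_eq_sum]
    simp
  calc _ = ((∑ i, ∑ a, 𝒟.inj i a * (𝒟.inj i a)ᴴ) * Y).trace := by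
        simp only [Matrix.sum_mul, Matrix.trace_sum]
        refine Finset.sum_congr rfl fun i _ => Finset.sum_congr rfl fun a _ => ?_
        rw [Matrix.trace_mul_comm, Matrix.mul_assoc]
    _ = Y.trace := by rw [h1, Matrix.one_mul]

/-- The compression of an operator on `A ⊗ B` to `Aᵢ ⊗ B`, traced over `Yᵢ`. -/
def blockTrace (Y : Matrix (n × n) (n × n) ℂ) (i : Fin 𝒟.r) :
    Matrix (Fin (𝒟.dA i) × n) (Fin (𝒟.dA i) × n) ℂ :=
  Matrix.of fun s t => ((𝒟.inj i s.1)ᴴ * slice Y s.2 t.2 * 𝒟.inj i t.1).trace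

/-- Each basis vector `y` of `Yᵢ` gives a map `|a⟩ ⊗ |k⟩ ↦ U(a ⊗ y) ⊗ |k⟩`, and the block trace is
the sum of the compressions of `Y` by these maps. -/
theorem blockTrace_posSemidef {Y : Matrix (n × n) (n × n) ℂ} (hY : Y.PosSemidef) (i) :
    (𝒟.blockTrace Y i).PosSemidef := by
  let V : Fin (𝒟.dY i) → Matrix (n × n) (Fin (𝒟.dA i) × n) ℂ := fun y =>
    Matrix.of fun p s => if p.2 = s.2 then 𝒟.U p.1 ⟨i, s.1, y⟩ else 0
  have : 𝒟.blockTrace Y i = ∑ y, (V y)ᴴ * Y * V y := by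
    ext ⟨a, k⟩ ⟨b, l⟩
    simp only [blockTrace, Matrix.of_apply, Matrix.sum_apply, Matrix.trace, Matrix.diag]
    refine Finset.sum_congr rfl fun y _ => ?_
    simp only [Matrix.mul_apply, V, Fintype.sum_prod_type, conjTranspose_apply, Matrix.of_apply,
      slice, inj, apply_ite star, star_zero, ite_mul, zero_mul, mul_ite, mul_zero,
      Finset.sum_ite_eq', Finset.mem_univ, if_true]
  rw [this]
  exact posSemidef_sum _ fun y _ => hY.conjTranspose_mul_mul_same _

/-- One block of `quad_condExp_le`. -/
theorem block_le {W R : Matrix n n ℂ} (hW : W.PosSemidef)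
    {Y : Matrix (n × n) (n × n) ℂ} (hY : Y.PosSemidef) (i : Fin 𝒟.r)
    {C : Matrix (Fin (𝒟.dY i)) (Fin (𝒟.dY i)) ℂ} (hC : Cᴴ = C)
    (hτ : ((𝒟.dY i : ℂ) • 1 - C * 𝒟.tau W i * C).PosSemidef) :
    ∑ k, ∑ l, ∑ a, ∑ b, ((𝒟.inj i a)ᴴ * slice Y k l * 𝒟.inj i b).trace *
        ((W * R)ᴴ * (𝒟.inj i a * (C * C) * (𝒟.inj i b)ᴴ) * (W * R)) k l ≤
      (𝒟.dY i : ℂ) * ∑ k, ∑ l, ∑ a,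
        ((𝒟.inj i a)ᴴ * slice Y k l * 𝒟.inj i a).trace * (Rᴴ * W * R) k l := by
  obtain ⟨B, hB, rfl⟩ := exists_sqrt hW
  -- The blocks `C (inj a)† √W` placed in a row: `T T†` is `C τ(W) C`, bounded by hypothesis, while
  -- `T†T` has the blocks `√W (inj a) C² (inj b)† √W` appearing on the left of the claim.
  let T : Matrix (Fin (𝒟.dY i)) (Fin (𝒟.dA i) × n) ℂ :=
    Matrix.of fun z s => (C * (𝒟.inj i s.1)ᴴ * B) z s.2
  have hT : T * Tᴴ = C * 𝒟.tau (B * B) i * C := by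
    have h1 : C * 𝒟.tau (B * B) i * C = ∑ a, (C * (𝒟.inj i a)ᴴ * B) * (C * (𝒟.inj i a)ᴴ * B)ᴴ := by
      rw [tau_eq_sum, Matrix.mul_sum, Matrix.sum_mul]
      refine Finset.sum_congr rfl fun a _ => ?_
      rw [conjTranspose_mul, conjTranspose_mul, conjTranspose_conjTranspose, hC, hB.1]
      simp only [Matrix.mul_assoc]
    rw [h1]
    ext z z'
    simp only [Matrix.sum_apply, Matrix.mul_apply (M := T), Fintype.sum_prod_type]
    rfl
  have hpos : (0 : ℂ) < 𝒟.dY i := Nat.cast_pos.2 (𝒟.dY_pos i)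
  have h2 := posSemidef_sub_conjTranspose_mul hpos (by rwa [hT])
  let K : Matrix (Fin (𝒟.dA i) × n) (Fin (𝒟.dA i) × n) ℂ :=
    kronecker (1 : Matrix (Fin (𝒟.dA i)) (Fin (𝒟.dA i)) ℂ) (B * R)
  -- The claim is the pairing of two positive matrices. The transpose turns the trace of a product
  -- into the entrywise sum `∑ X s t * Z s t`.
  have h3 := trace_mul_nonneg (𝒟.blockTrace_posSemidef hY i)
    (h2.conjTranspose_mul_mul_same K).transpose
  have hK1 : Kᴴ * ((𝒟.dY i : ℂ) • 1) * K = (𝒟.dY i : ℂ) •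
      kronecker (1 : Matrix (Fin (𝒟.dA i)) (Fin (𝒟.dA i)) ℂ) (Rᴴ * (B * B) * R) := by
    rw [Matrix.mul_smul, Matrix.mul_one, smul_mul]
    congr 1
    refine (congrArg (· * K) (conjTranspose_kronecker _ _)).trans ?_
    refine (Matrix.mul_kronecker_mul _ _ _ _).symm.trans ?_
    rw [conjTranspose_one, Matrix.one_mul, conjTranspose_mul, hB.1]
    simp only [Matrix.mul_assoc]
    rfl
  have hK2 : ∀ a k b l, (Kᴴ * (Tᴴ * T) * K) (a, k) (b, l) =
      ((B * B * R)ᴴ * (𝒟.inj i a * (C * C) * (𝒟.inj i b)ᴴ) * (B * B * R)) k l := by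
    have hTK : ∀ z b l, (T * K) z (b, l) = (C * (𝒟.inj i b)ᴴ * (B * B * R)) z l := by
      intro z b l
      have : C * (𝒟.inj i b)ᴴ * (B * B * R) = (C * (𝒟.inj i b)ᴴ * B) * (B * R) := by
        simp only [Matrix.mul_assoc]
      rw [this, Matrix.mul_apply, Matrix.mul_apply, Fintype.sum_prod_type,
        Finset.sum_eq_single b]
      · simp [T, K, kronecker]
      · intro b' _ hb
        simp [K, kronecker, hb]
      · simp
    intro a k b l
    have h1 : Kᴴ * (Tᴴ * T) * K = (T * K)ᴴ * (T * K) := by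
      rw [conjTranspose_mul]
      simp only [Matrix.mul_assoc]
    have h2 : (B * B * R)ᴴ * (𝒟.inj i a * (C * C) * (𝒟.inj i b)ᴴ) * (B * B * R) =
        (C * (𝒟.inj i a)ᴴ * (B * B * R))ᴴ * (C * (𝒟.inj i b)ᴴ * (B * B * R)) := by
      rw [conjTranspose_mul (C * (𝒟.inj i a)ᴴ), conjTranspose_mul C, hC,
        conjTranspose_conjTranspose]
      simp only [Matrix.mul_assoc]
    rw [h1, h2, Matrix.mul_apply, Matrix.mul_apply]
    simp only [conjTranspose_apply, hTK]
  have hre : ∀ F : Fin (𝒟.dA i) × n → Fin (𝒟.dA i) × n → ℂ,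
      ∑ s, ∑ t, F s t = ∑ k, ∑ l, ∑ a, ∑ b, F (a, k) (b, l) := by
    intro F
    rw [Fintype.sum_prod_type, Finset.sum_comm]
    refine Finset.sum_congr rfl fun k _ => ?_
    simp only [Fintype.sum_prod_type]
    conv_rhs => rw [Finset.sum_comm]
    refine Finset.sum_congr rfl fun a _ => ?_
    rw [Finset.sum_comm]
  rw [Matrix.mul_sub, Matrix.sub_mul, hK1, transpose_sub, Matrix.mul_sub, Matrix.trace_sub,
    sub_nonneg] at h3
  have htr : ∀ X Z : Matrix (Fin (𝒟.dA i) × n) (Fin (𝒟.dA i) × n) ℂ,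
      (X * Zᵀ).trace = ∑ k, ∑ l, ∑ a, ∑ b, X (a, k) (b, l) * Z (a, k) (b, l) := by
    intro X Z
    rw [← hre fun s t => X s t * Z s t]
    rfl
  rw [htr, htr] at h3
  simp only [hK2] at h3
  refine h3.trans (le_of_eq ?_)
  simp only [Finset.mul_sum]
  refine Finset.sum_congr rfl fun k _ => Finset.sum_congr rfl fun l _ =>
    Finset.sum_congr rfl fun a _ => ?_
  rw [Finset.sum_eq_single a]
  · simp [blockTrace, kronecker, mul_left_comm]
  · intro b _ hb
    simp [kronecker, hb.symm]
  · simp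

/-- The weight `(dim Yᵢ)⁻¹` in `E` cancels the bound `dim Yᵢ` of each block. The remaining traces
over all blocks add up to the entries of `Tr_A Y`, which is at most `lam • 1`. -/
theorem quad_condExp_le {W R : Matrix n n ℂ} (hW : W.PosSemidef)
    {Y : Matrix (n × n) (n × n) ℂ} (hY : Y.PosSemidef) {lam : ℝ}
    (hlam : ((lam : ℂ) • (1 : Matrix n n ℂ) - traceA Y).PosSemidef)
    {C : ∀ i, Matrix (Fin (𝒟.dY i)) (Fin (𝒟.dY i)) ℂ} (hC : ∀ i, (C i)ᴴ = C i)
    (hτ : ∀ i, ((𝒟.dY i : ℂ) • 1 - C i * 𝒟.tau W i * C i).PosSemidef) :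
    quad (fun k l => 𝒟.ofComm (fun i => C i * C i) * 𝒟.condExp (slice Y k l)) (W * R) ≤
      lam * (Rᴴ * W * R).trace := by
  have hM : (Rᴴ * W * R).PosSemidef := hW.conjTranspose_mul_mul_same R
  calc quad (fun k l => 𝒟.ofComm (fun i => C i * C i) * 𝒟.condExp (slice Y k l)) (W * R)
      = ∑ i, (𝒟.dY i : ℂ)⁻¹ * ∑ k, ∑ l, ∑ a, ∑ b,
        ((𝒟.inj i a)ᴴ * slice Y k l * 𝒟.inj i b).trace *
        ((W * R)ᴴ * (𝒟.inj i a * (C i * C i) * (𝒟.inj i b)ᴴ) * (W * R)) k l := by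
        simp only [quad, ofComm_mul_condExp_eq_sum, Matrix.sum_mul,
          Matrix.sum_apply, Finset.mul_sum, Matrix.mul_smul, smul_mul, Matrix.smul_apply,
          smul_eq_mul, mul_assoc]
        conv_rhs => rw [Finset.sum_comm]
        refine Finset.sum_congr rfl fun k _ => ?_
        rw [Finset.sum_comm]
    _ ≤ ∑ i, (𝒟.dY i : ℂ)⁻¹ * ((𝒟.dY i : ℂ) * ∑ k, ∑ l, ∑ a,
        ((𝒟.inj i a)ᴴ * slice Y k l * 𝒟.inj i a).trace * (Rᴴ * W * R) k l) := by
        refine Finset.sum_le_sum fun i _ => ?_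
        exact mul_le_mul_of_nonneg_left (𝒟.block_le hW hY i (hC i) (hτ i))
          (inv_nonneg.2 (Nat.cast_nonneg _))
    _ = ∑ k, ∑ l, traceA Y k l * (Rᴴ * W * R) k l := by
        have h0 : ∀ i, (𝒟.dY i : ℂ) ≠ 0 := fun i => Nat.cast_ne_zero.2 (𝒟.dY_pos i).ne'
        simp only [inv_mul_cancel_left₀ (h0 _)]
        rw [Finset.sum_comm]
        refine Finset.sum_congr rfl fun k _ => ?_
        rw [Finset.sum_comm]
        refine Finset.sum_congr rfl fun l _ => ?_
        simp only [← Finset.sum_mul, sum_trace_inj]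
        rfl
    _ ≤ lam * (Rᴴ * W * R).trace := by
        have h := trace_mul_nonneg hlam hM.transpose
        rw [Matrix.sub_mul, Matrix.trace_sub, sub_nonneg, smul_mul, Matrix.one_mul,
          Matrix.trace_smul, Matrix.trace_transpose, smul_eq_mul] at h
        exact h

end VertexDecomposition

end

section

/-! ### The weighted theta function -/

section Theta

variable {n : Type*} [Fintype n] [DecidableEq n]

open scoped MatrixOrder in
theorem sqrtVec_apply (W : Matrix n n ℂ) (p : n × n) : sqrtVec W p = CFC.sqrt W p.1 p.2 := by
  simp [sqrtVec, mulVec, dotProduct, maxEnt, Fintype.sum_prod_type, kronecker, Matrix.one_apply]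

theorem posSemidef_ketbra {m : Type*} [Fintype m] (v : m → ℂ) : (ketbra v).PosSemidef :=
  posSemidef_vecMulVec_self_star v

theorem exists_posSemidef_smul_one_sub_ketbra {m : Type*} [Fintype m] [DecidableEq m]
    (v : m → ℂ) : ∃ c : ℝ, ((c : ℂ) • (1 : Matrix m m ℂ) - ketbra v).PosSemidef := by
  let T : Matrix Unit m ℂ := Matrix.of fun _ i => star (v i)
  -- The extra `1` keeps `c` positive when `v = 0`.
  let c : ℝ := (∑ i, Complex.normSq (v i)) + 1
  have hc : 0 < c := by
    have : 0 ≤ ∑ i, Complex.normSq (v i) := Finset.sum_nonneg fun i _ => Complex.normSq_nonneg _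
    positivity
  have h1 : (c : ℂ) • (1 : Matrix Unit Unit ℂ) - T * Tᴴ = 1 := by
    ext
    simp [T, c, Matrix.mul_apply, Complex.normSq_eq_conj_mul_self]
  have h2 : Tᴴ * T = ketbra v := by
    ext i j
    simp [T, Matrix.mul_apply, ketbra, vecMulVec_apply]
  refine ⟨c, ?_⟩
  rw [← h2]
  exact posSemidef_sub_conjTranspose_mul (by exact_mod_cast hc) (by rw [h1]; exact .one)

variable {S : Submodule ℂ (Matrix n n ℂ)}

theorem theta_feasible_nonempty (hS : (1 : Matrix n n ℂ) ∈ S) (W : Matrix n n ℂ) :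
    {lam : ℝ | ∃ Y ∈ tensorFull S,
      ((lam : ℂ) • (1 : Matrix n n ℂ) - traceA Y).PosSemidef ∧
      (Y - ketbra (sqrtVec W)).PosSemidef}.Nonempty := by
  obtain ⟨c, hc⟩ := exists_posSemidef_smul_one_sub_ketbra (sqrtVec W)
  refine ⟨c * Fintype.card n, (c : ℂ) • 1, ?_, ?_, hc⟩
  · refine Submodule.smul_mem _ _ (Submodule.subset_span ⟨1, hS, 1, ?_⟩)
    exact one_kronecker_one.symm
  · have : traceA ((c : ℂ) • (1 : Matrix (n × n) (n × n) ℂ)) =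
        ((c * Fintype.card n : ℝ) : ℂ) • 1 := by
      ext k l
      by_cases h : k = l <;> simp [traceA, Matrix.one_apply, h, mul_comm]
    rw [this, sub_self]
    exact .zero

/-- Feasibility forces `lam • 1 ≥ Tr_A Y ≥ 0`. A diagonal entry is needed to conclude `lam ≥ 0`;
over an empty index type every real is feasible. -/
theorem theta_feasible_bddBelow [Nonempty n] (W : Matrix n n ℂ) :
    BddBelow {lam : ℝ | ∃ Y ∈ tensorFull S,
      ((lam : ℂ) • (1 : Matrix n n ℂ) - traceA Y).PosSemidef ∧
      (Y - ketbra (sqrtVec W)).PosSemidef} := by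
  refine ⟨0, ?_⟩
  rintro lam ⟨Y, -, h1, h2⟩
  have hY : Y.PosSemidef := by
    have := h2.add (posSemidef_ketbra (sqrtVec W))
    rwa [sub_add_cancel] at this
  have h3 := h1.add (traceA_posSemidef hY)
  rw [sub_add_cancel] at h3
  have h4 := h3.diag_nonneg (i := Classical.arbitrary n)
  simpa using h4

/-! ### The first inclusion. -/

/-- A full projection has weighted theta function at most one. -/
theorem theta_le_one [Nonempty n] {P : Matrix n n ℂ} (hP : IsFullProj S P) :
    theta S P ≤ 1 := by
  have hsq : ∀ p, sqrtVec P p = P p.1 p.2 := by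
    intro p
    rw [sqrtVec_apply]
    open scoped MatrixOrder in
    rw [CFC.sqrt_unique hP.2.1 (posSemidef_of_proj hP.1 hP.2.1).nonneg]
  have hstar : ∀ i j, star (P i j) = P j i := fun i j => congrFun (congrFun hP.1 j) i
  -- Since `√P = P`, the rank-one operator itself is feasible with value `1`.
  refine csInf_le (theta_feasible_bddBelow P) ⟨ketbra (sqrtVec P), ?_, ?_, ?_⟩
  · refine mem_tensorFull fun k l => ?_
    have : slice (ketbra (sqrtVec P)) k l = P * Matrix.single k l 1 * P := by
      ext i j
      rw [Matrix.mul_apply, Finset.sum_eq_single l]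
      · simp [slice, ketbra, vecMulVec_apply, hsq, ← hstar j l]
      · intro x _ hx
        simp [Matrix.mul_apply, hx.symm]
      · simp
    rw [this]
    exact hP.2.2 _
  · have : traceA (ketbra (sqrtVec P)) = Pᵀ := by
      ext k l
      have h : P l k = ∑ i, P l i * P i k := by
        rw [← Matrix.mul_apply, hP.2.1]
      rw [transpose_apply, h]
      refine Finset.sum_congr rfl fun i _ => ?_
      rw [ketbra, vecMulVec_apply, Pi.star_apply, hsq, hsq, hstar, mul_comm]
    rw [this, Complex.ofReal_one, one_smul, ← transpose_one, ← transpose_sub]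
    exact (posSemidef_one_sub_of_proj hP.1 hP.2.1).transpose
  · rw [sub_self]
    exact .zero

theorem fp_subset_antiblocker_thetaBody :
    fp S ⊆ antiblocker (thetaBody S) := by
  rintro Z ⟨hZ, Q, hQ, hZQ⟩
  refine ⟨hZ, fun X hX => ?_⟩
  rcases isEmpty_or_nonempty n with h | h
  · simp [Matrix.trace]
  let f : Matrix n n ℂ →ₗ[ℝ] ℝ :=
    Complex.reLm ∘ₗ (Matrix.traceLinearMap n ℝ ℂ) ∘ₗ LinearMap.mulLeft ℝ X
  have hf : Continuous f := f.continuous_of_finiteDimensional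
  -- A closed half-space containing the full projections contains their closed convex hull.
  have hsub : closure (convexHull ℝ {P | IsFullProj S P}) ⊆ {Q | f Q ≤ 1} := by
    refine closure_minimal (convexHull_min ?_ ?_) (isClosed_le hf continuous_const)
    · intro P hP
      exact hX.2 P (posSemidef_of_proj hP.1 hP.2.1) (theta_le_one hP)
    · exact convex_halfSpace_le f.isLinear 1
  have h1 : (X * Q).trace.re ≤ 1 := hsub hQ
  have h2 := (Complex.le_def.1 (trace_mul_nonneg hX.1 hZQ)).1
  rw [Matrix.mul_sub, Matrix.trace_sub, Complex.sub_re, Complex.zero_re] at h2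
  linarith

end Theta

/-! ### Projections dominating in the commutant -/

theorem isClosed_posSemidef {n : Type*} [Fintype n] :
    IsClosed {M : Matrix n n ℂ | M.PosSemidef} := by
  simp only [posSemidef_iff_dotProduct_mulVec, Set.ofPred_and, Set.ofPred_forall]
  refine IsClosed.inter ?_ (isClosed_iInter fun x => ?_)
  · exact isClosed_eq (continuous_id.matrix_conjTranspose) continuous_id
  · exact isClosed_le continuous_const
      (continuous_const.dotProduct (continuous_id.matrix_mulVec continuous_const))

/-- From `p = p†p`, `p j j` is the sum of the `‖p i j‖²`. Taking `i = j` bounds the diagonal, and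
then every entry. This places projections in the compact box of `testSet`. -/
theorem norm_le_one_of_proj {m : Type*} [Fintype m] {p : Matrix m m ℂ} (hp : pᴴ = p)
    (hpp : p * p = p) (i j : m) : ‖p i j‖ ≤ 1 := by
  have h : ∀ i j, ‖p i j‖ ^ 2 ≤ ‖p j j‖ := by
    intro i j
    have h1 : p j j = ((∑ i, ‖p i j‖ ^ 2 : ℝ) : ℂ) := by
      conv_lhs => rw [← hpp, Matrix.mul_apply]
      push_cast
      refine Finset.sum_congr rfl fun k _ => ?_
      rw [← Complex.conj_mul', ← hp, conjTranspose_apply, hp]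
      rfl
    rw [h1, Complex.norm_real, Real.norm_of_nonneg (Finset.sum_nonneg fun _ _ => sq_nonneg _)]
    exact Finset.single_le_sum (f := fun i => ‖p i j‖ ^ 2) (fun _ _ => sq_nonneg _)
      (Finset.mem_univ i)
  have h1 := h i j
  have h2 := h j j
  have h3 := norm_nonneg (p j j)
  have h4 : ‖p j j‖ ≤ 1 := by nlinarith
  exact (sq_le_one_iff₀ (norm_nonneg _)).1 (h1.trans h4)

variable {n : Type*} [Fintype n] [DecidableEq n] {S₀ : StarSubalgebra ℂ (Matrix n n ℂ)}
  {S : Submodule ℂ (Matrix n n ℂ)}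

namespace VertexDecomposition

variable (𝒟 : VertexDecomposition S₀)

/-- `ofComm` as a linear map. -/
def ofCommₗ : (∀ i, Matrix (Fin (𝒟.dY i)) (Fin (𝒟.dY i)) ℂ) →ₗ[ℂ] Matrix n n ℂ where
  toFun := 𝒟.ofComm
  map_add' := 𝒟.ofComm_add
  map_smul' := 𝒟.ofComm_smul

theorem continuous_ofComm : Continuous 𝒟.ofComm :=
  𝒟.ofCommₗ.continuous_of_finiteDimensional

theorem ofComm_real_smul (c : ℝ) (q) : 𝒟.ofComm (c • q) = c • 𝒟.ofComm q :=
  𝒟.ofComm_smul (c : ℂ) q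

/-- The bounded `q` for which `|⟨qx|r⟩|² ≤ ⟨x|(q ⊗ I) E(Y)|x⟩` at all vectors `x`. -/
def testSet (Y : Matrix (n × n) (n × n) ℂ) (R : Matrix n n ℂ) :
    Set (∀ i, Matrix (Fin (𝒟.dY i)) (Fin (𝒟.dY i)) ℂ) :=
  {q | (∀ X : Matrix n n ℂ, Complex.normSq (Rᴴ * (𝒟.ofComm q * X)).trace ≤
      (quad (fun k l => 𝒟.ofComm q * 𝒟.condExp (slice Y k l)) X).re) ∧
    ∀ i y z, ‖q i y z‖ ≤ 1}

/-- In the defining inequality, `q` enters through a squared modulus of a linear form on the left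
and linearly on the right. -/
theorem convex_testSet (Y R) : Convex ℝ (𝒟.testSet Y R) := by
  intro q hq q' hq' a b ha hb hab
  refine ⟨fun X => ?_, fun i y z => ?_⟩
  · have h1 := hq.1 X
    have h2 := hq'.1 X
    have e1 : (quad (fun k l => 𝒟.ofComm (a • q + b • q') * 𝒟.condExp (slice Y k l)) X).re =
        a * (quad (fun k l => 𝒟.ofComm q * 𝒟.condExp (slice Y k l)) X).re +
        b * (quad (fun k l => 𝒟.ofComm q' * 𝒟.condExp (slice Y k l)) X).re := by
      simp only [quad, ofComm_add, ofComm_real_smul, Matrix.add_mul, Matrix.mul_add, smul_mul,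
        Matrix.mul_smul, Matrix.add_apply, Matrix.smul_apply, Finset.sum_add_distrib,
        ← Finset.smul_sum, Complex.add_re, Complex.smul_re, smul_eq_mul]
    rw [e1, ofComm_add, ofComm_real_smul, ofComm_real_smul, Matrix.add_mul, Matrix.mul_add,
      Matrix.trace_add, smul_mul, smul_mul, Matrix.mul_smul, Matrix.mul_smul,
      Matrix.trace_smul, Matrix.trace_smul]
    refine le_trans ?_ (add_le_add (mul_le_mul_of_nonneg_left h1 ha)
      (mul_le_mul_of_nonneg_left h2 hb))
    generalize (Rᴴ * (𝒟.ofComm q * X)).trace = u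
    generalize (Rᴴ * (𝒟.ofComm q' * X)).trace = v
    obtain rfl : b = 1 - a := by linarith
    simp only [Complex.normSq_apply, Complex.add_re, Complex.add_im, Complex.smul_re,
      Complex.smul_im, smul_eq_mul]
    -- The convexity gap of the squared modulus is `a b |u - v|²`.
    nlinarith [mul_nonneg (mul_nonneg ha hb) (sq_nonneg (u.re - v.re)),
      mul_nonneg (mul_nonneg ha hb) (sq_nonneg (u.im - v.im))]
  · have h1 := hq.2 i y z
    have h2 := hq'.2 i y z
    calc ‖a • q i y z + b • q' i y z‖ ≤ ‖a • q i y z‖ + ‖b • q' i y z‖ := norm_add_le _ _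
      _ = a * ‖q i y z‖ + b * ‖q' i y z‖ := by
        rw [norm_smul, norm_smul, Real.norm_of_nonneg ha, Real.norm_of_nonneg hb]
      _ ≤ a * 1 + b * 1 := by gcongr
      _ = 1 := by rw [mul_one, mul_one, hab]

theorem isCompact_testSet (Y R) : IsCompact (𝒟.testSet Y R) := by
  have h1 : IsCompact {q : ∀ i, Matrix (Fin (𝒟.dY i)) (Fin (𝒟.dY i)) ℂ |
      ∀ i y z, ‖q i y z‖ ≤ 1} := by
    have := isCompact_univ_pi fun i => isCompact_univ_pi fun _ : Fin (𝒟.dY i) =>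
      isCompact_univ_pi fun _ : Fin (𝒟.dY i) => isCompact_closedBall (0 : ℂ) 1
    refine (congrArg IsCompact (Set.ext fun q => ?_)).mp this
    exact ⟨fun h i y z => mem_closedBall_zero_iff.1 (h i trivial y trivial z trivial),
      fun h i _ y _ z _ => mem_closedBall_zero_iff.2 (h i y z)⟩
  have h2 : IsClosed {q : ∀ i, Matrix (Fin (𝒟.dY i)) (Fin (𝒟.dY i)) ℂ |
      ∀ X : Matrix n n ℂ, Complex.normSq (Rᴴ * (𝒟.ofComm q * X)).trace ≤
      (quad (fun k l => 𝒟.ofComm q * 𝒟.condExp (slice Y k l)) X).re} := by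
    rw [Set.ofPred_forall]
    have hc := 𝒟.continuous_ofComm
    refine isClosed_iInter fun X => isClosed_le ?_ ?_
    · exact Complex.continuous_normSq.comp
        ((continuous_const.matrix_mul (hc.matrix_mul continuous_const)).matrix_trace)
    · refine Complex.continuous_re.comp (continuous_finsetSum _ fun k _ =>
        continuous_finsetSum _ fun l _ => Continuous.matrix_elem ?_ k l)
      exact (continuous_const.matrix_mul (hc.matrix_mul continuous_const)).matrix_mul
        continuous_const
  exact h1.inter_left h2

/-- Everything in `FP(S^c)` lies below an element of the test set. -/
theorem exists_testSet_of_mem_fp (hS : IsS0Graph S₀ S) {Y : Matrix (n × n) (n × n) ℂ}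
    (hY : Y ∈ tensorFull S) {R : Matrix n n ℂ}
    (hYR : (Y - ketbra fun p : n × n => R p.1 p.2).PosSemidef) {Z : Matrix n n ℂ}
    (hZ : Z ∈ fp (compl S₀ S)) : ∃ q ∈ 𝒟.testSet Y R, (𝒟.ofComm q - Z).PosSemidef := by
  obtain ⟨-, Q, hQ, hZQ⟩ := hZ
  let D : Set (Matrix n n ℂ) := {Q | ∃ q ∈ 𝒟.testSet Y R, (𝒟.ofComm q - Q).PosSemidef}
  have hclosed : IsClosed D := by
    -- `D` is the sum of a compact set and the closed cone of negative semidefinite matrices, hence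
    -- closed; this is what the entry bound in `testSet` buys.
    have h1 := ((𝒟.isCompact_testSet Y R).image 𝒟.continuous_ofComm)
    have h2 : IsClosed {M : Matrix n n ℂ | (-M).PosSemidef} :=
      isClosed_posSemidef.preimage continuous_neg
    have h3 := h2.add_left_of_isCompact h1
    convert h3 using 1
    ext Q
    constructor
    · rintro ⟨q, hq, h⟩
      exact ⟨_, ⟨q, hq, rfl⟩, Q - 𝒟.ofComm q, by simpa using h, by simp⟩
    · rintro ⟨_, ⟨q, hq, rfl⟩, M, hM, rfl⟩
      exact ⟨q, hq, by simpa using hM⟩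
  have hconv : Convex ℝ D := by
    rintro Q ⟨q, hq, h⟩ Q' ⟨q', hq', h'⟩ a b ha hb hab
    refine ⟨a • q + b • q', 𝒟.convex_testSet Y R hq hq' ha hb hab, ?_⟩
    have := (h.smul ha).add (h'.smul hb)
    rw [ofComm_add, ofComm_real_smul, ofComm_real_smul]
    convert this using 1
    rw [smul_sub, smul_sub]
    abel
  have hfull : {P | IsFullProj (compl S₀ S) P} ⊆ D := by
    intro P hP
    obtain ⟨q, hq1, hq2, hq3, hq4⟩ := 𝒟.exists_fullProj_ofComm hS hP
    refine ⟨q, ⟨fun X => ?_, fun i => norm_le_one_of_proj (hq1 i) (hq2 i)⟩, hq4⟩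
    -- Evaluate `Y ≥ |R⟩⟨R|` at `qx`; then `q Z q = q E(Z) q = q E(Z)` on each slice, as `q` is a
    -- projection commuting with `S₀`.
    have h1 := (Complex.le_def.1 (normSq_trace_le_quad hYR (𝒟.ofComm q * X))).1
    have h2 : Complex.normSq ((𝒟.ofComm q * X)ᴴ * R).trace =
        Complex.normSq (Rᴴ * (𝒟.ofComm q * X)).trace := by
      rw [← conjTranspose_conjTranspose R, ← conjTranspose_mul, trace_conjTranspose,
        conjTranspose_conjTranspose]
      exact Complex.normSq_conj _
    rw [Complex.ofReal_re, h2] at h1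
    refine h1.trans (le_of_eq ?_)
    congr 1
    refine Finset.sum_congr rfl fun k _ => Finset.sum_congr rfl fun l _ => ?_
    refine congrArg (fun M : Matrix n n ℂ => M k l) ?_
    have h3 := 𝒟.compress_eq hS hq3 (slice_mem hY k l)
    calc (𝒟.ofComm q * X)ᴴ * slice Y k l * (𝒟.ofComm q * X)
        = Xᴴ * (𝒟.ofComm q * slice Y k l * 𝒟.ofComm q) * X := by
          rw [conjTranspose_mul, hq3.1]
          simp only [Matrix.mul_assoc]
      _ = Xᴴ * (𝒟.ofComm q * 𝒟.condExp (slice Y k l)) * X := by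
          rw [h3, Matrix.mul_assoc (𝒟.ofComm q), ← ofComm_mul_condExp,
            ← Matrix.mul_assoc (𝒟.ofComm q), hq3.2.1]
  obtain ⟨q, hq, h⟩ := closure_minimal (convexHull_min hfull hconv) hclosed hQ
  refine ⟨q, hq, ?_⟩
  have := h.add hZQ
  rwa [sub_add_sub_cancel] at this

/-! ### The second inclusion. -/

/-- The main estimate: weak duality for the weighted theta function. -/
theorem trace_le_of_feasible (hS : IsS0Graph S₀ S) {Y : Matrix (n × n) (n × n) ℂ}
    (hY : Y ∈ tensorFull S) {R : Matrix n n ℂ}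
    (hYR : (Y - ketbra fun p : n × n => R p.1 p.2).PosSemidef) {lam : ℝ}
    (hlam : ((lam : ℂ) • (1 : Matrix n n ℂ) - traceA Y).PosSemidef)
    {W : Matrix n n ℂ} (hW : W.PosSemidef) (hWfp : 𝒟.blockscale W ∈ fp (compl S₀ S)) :
    (Rᴴ * W * R).trace.re ≤ max lam 0 := by
  obtain ⟨q, hq, hqW⟩ := 𝒟.exists_testSet_of_mem_fp hS hY hYR hWfp
  have hYp : Y.PosSemidef := by
    have := hYR.add (posSemidef_ketbra fun p : n × n => R p.1 p.2)
    rwa [sub_add_cancel] at this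
  rw [blockscale_eq, ← ofComm_sub] at hqW
  have hpos : ∀ i, (0 : ℂ) < 𝒟.dY i := fun i => Nat.cast_pos.2 (𝒟.dY_pos i)
  have hle : ∀ i, (q i - ((𝒟.dY i : ℂ)⁻¹) • 𝒟.tau W i).PosSemidef :=
    𝒟.posSemidef_of_ofComm hqW
  have hτ : ∀ i, (((𝒟.dY i : ℂ)⁻¹) • 𝒟.tau W i).PosSemidef := fun i =>
    (𝒟.tau_posSemidef hW i).smul (inv_nonneg.2 (hpos i).le)
  have hqp : ∀ i, (q i).PosSemidef := fun i => by
    have := (hle i).add (hτ i)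
    rwa [sub_add_cancel] at this
  choose C hC1 hC2 hC3 using fun i => exists_pinv_sqrt (hqp i)
  -- `q C²` is the support projection of `q`. It fixes `Ψ(W) ≤ q`, hence each partial trace of `W`,
  -- hence `W`.
  have hπ : ∀ i, (q i * (C i * C i))ᴴ = q i * (C i * C i) := fun i => by
    rw [conjTranspose_mul, conjTranspose_mul, hC1, (hqp i).1, Matrix.mul_assoc, hC2,
      ← Matrix.mul_assoc, hC2, Matrix.mul_assoc]
  have hπW : 𝒟.ofComm (fun i => q i * (C i * C i)) * W = W := by
    refine 𝒟.ofComm_mul_eq_self hW hπ fun i => ?_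
    have := mul_eq_self_of_le (hτ i) (hle i) (hπ i) (by rw [← Matrix.mul_assoc, hC3])
    rw [Matrix.mul_smul] at this
    exact smul_right_injective _ (inv_ne_zero (hpos i).ne') this
  -- Conjugate `τ(W)/dim Y ≤ q` by `C`: the upper bound `C q C` is a projection, so at most `1`.
  have hCτ : ∀ i, ((𝒟.dY i : ℂ) • 1 - C i * 𝒟.tau W i * C i).PosSemidef := fun i => by
    have h1 := (hle i).conjTranspose_mul_mul_same (C i)
    have h2 : (1 - C i * q i * C i).PosSemidef := by
      apply posSemidef_one_sub_of_proj
      · rw [conjTranspose_mul, conjTranspose_mul, hC1, (hqp i).1, Matrix.mul_assoc]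
      · calc C i * q i * C i * (C i * q i * C i) = C i * (q i * C i * C i * q i) * C i := by
              simp only [Matrix.mul_assoc]
          _ = C i * q i * C i := by rw [hC3]
    have h3 := (h2.add h1).smul (hpos i).le
    convert h3 using 1
    rw [hC1, Matrix.mul_sub, Matrix.sub_mul, sub_add_sub_cancel, smul_sub, Matrix.mul_smul,
      smul_mul, smul_smul, mul_inv_cancel₀ (hpos i).ne', one_smul]
  have h1 := (Complex.le_def.1 (𝒟.quad_condExp_le (R := R) hW hYp hlam hC1 hCτ)).1
  -- The test vector `x = C² W R` plays the role of `q⁻¹ W R`, so that `qx = W R`.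
  have h2 := hq.1 (𝒟.ofComm (fun i => C i * C i) * (W * R))
  have hqX : 𝒟.ofComm q * (𝒟.ofComm (fun i => C i * C i) * (W * R)) = W * R := by
    rw [← Matrix.mul_assoc, ofComm_mul, ← Matrix.mul_assoc, hπW]
  have h3 : quad (fun k l => 𝒟.ofComm q * 𝒟.condExp (slice Y k l))
      (𝒟.ofComm (fun i => C i * C i) * (W * R)) =
      quad (fun k l => 𝒟.ofComm (fun i => C i * C i) * 𝒟.condExp (slice Y k l)) (W * R) := by
    refine Finset.sum_congr rfl fun k _ => Finset.sum_congr rfl fun l _ => ?_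
    refine congrArg (fun M : Matrix n n ℂ => M k l) ?_
    have hCC : (𝒟.ofComm fun i => C i * C i)ᴴ = 𝒟.ofComm fun i => C i * C i := by
      rw [ofComm_conjTranspose]
      simp only [conjTranspose_mul, hC1]
    have hcomm : 𝒟.ofComm (fun i => C i * C i) * 𝒟.ofComm q =
        𝒟.ofComm fun i => q i * (C i * C i) := by
      rw [ofComm_mul]
      congr 1
      funext i
      rw [Matrix.mul_assoc, hC2, ← Matrix.mul_assoc, hC2, Matrix.mul_assoc]
    have hWq : Wᴴ * 𝒟.ofComm (fun i => q i * (C i * C i)) = Wᴴ := by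
      have := congrArg conjTranspose hπW
      rw [conjTranspose_mul, ofComm_conjTranspose] at this
      simpa only [hπ] using this
    rw [conjTranspose_mul, hCC, conjTranspose_mul]
    calc Rᴴ * Wᴴ * 𝒟.ofComm (fun i => C i * C i) * (𝒟.ofComm q * 𝒟.condExp (slice Y k l)) *
          (𝒟.ofComm (fun i => C i * C i) * (W * R))
        = Rᴴ * (Wᴴ * (𝒟.ofComm (fun i => C i * C i) * 𝒟.ofComm q)) *
          (𝒟.condExp (slice Y k l) * 𝒟.ofComm (fun i => C i * C i)) * (W * R) := by
          simp only [Matrix.mul_assoc]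
      _ = _ := by rw [hcomm, hWq, ← ofComm_mul_condExp]
  have ht := hW.conjTranspose_mul_mul_same R |>.trace_nonneg
  obtain ⟨ht1, ht2⟩ := Complex.nonneg_iff.1 ht
  rw [hqX, h3, ← Matrix.mul_assoc, Complex.normSq_apply, ← ht2] at h2
  rw [Complex.re_ofReal_mul] at h1
  -- What remains is `t² ≤ lam * t` with `t ≥ 0`. The case `t = 0` is the reason for the maximum
  -- with `0` in the bound.
  generalize (Rᴴ * W * R).trace.re = t at *
  rcases ht1.eq_or_lt with h | h
  · rw [← h]
    exact le_max_right _ _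
  · refine le_max_of_le_left (le_of_mul_le_mul_right ?_ h)
    linarith

open scoped MatrixOrder in
theorem mem_thetaBody (hS : IsS0Graph S₀ S) {W : Matrix n n ℂ} (hW : W.PosSemidef)
    (hWfp : 𝒟.blockscale W ∈ fp (compl S₀ S)) : W ∈ thetaBody S := by
  refine ⟨hW, fun V hV hθ => le_of_forall_pos_le_add fun ε hε => ?_⟩
  -- Working up to `ε` avoids showing that the infimum is attained.
  obtain ⟨lam, ⟨Y, hY, hlam, hYV⟩, hlt⟩ := exists_lt_of_csInf_lt
    (theta_feasible_nonempty hS.one_mem V) (lt_of_le_of_lt hθ (lt_add_of_pos_right 1 hε))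
  have hsq : sqrtVec V = fun p : n × n => CFC.sqrt V p.1 p.2 := funext (sqrtVec_apply V)
  rw [hsq] at hYV
  have h := 𝒟.trace_le_of_feasible hS hY hYV hlam hW hWfp
  have hB : (CFC.sqrt V)ᴴ = CFC.sqrt V := (nonneg_iff_posSemidef.1 (CFC.sqrt_nonneg V)).1
  have hBB : CFC.sqrt V * CFC.sqrt V = V := CFC.sqrt_mul_sqrt_self V hV.nonneg
  rw [hB, Matrix.mul_assoc, Matrix.trace_mul_comm, Matrix.mul_assoc, hBB] at h
  exact h.trans (max_le hlt.le (by positivity))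

theorem antiblocker_thetaBody_subset (hS : IsS0Graph S₀ S) :
    antiblocker (thetaBody S) ⊆ 𝒟.psiAntiblocker (fp (compl S₀ S)) :=
  fun _ hT => ⟨hT.1, fun _ hW => hT.2 _ (𝒟.mem_thetaBody hS hW.1 hW.2)⟩

end VertexDecomposition

end

end NCGraph

end

theorem mainTheorem6 {n : Type*} [Fintype n] [DecidableEq n]
    (S₀ : StarSubalgebra ℂ (Matrix n n ℂ)) (S : Submodule ℂ (Matrix n n ℂ))
    (hS : NCGraph.IsS0Graph S₀ S) :
    NCGraph.fp S ⊆ NCGraph.antiblocker (NCGraph.thetaBody S) ∧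
    ∀ 𝒟 : NCGraph.VertexDecomposition S₀,
      NCGraph.antiblocker (NCGraph.thetaBody S) ⊆
        𝒟.psiAntiblocker (NCGraph.fp (NCGraph.compl S₀ S)) :=
  ⟨NCGraph.fp_subset_antiblocker_thetaBody, fun 𝒟 => 𝒟.antiblocker_thetaBody_subset hS⟩
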